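/- A $d$-class association scheme $\mathfrak X=(X,\{R_i\}_{i=0}^d)$ is a finite set $X$ together with nonempty relations $R_0,\dots,R_d\subseteq X\times X$ such that $R_0$ is the diagonal relation; $R_0,\dots,R_d$ partition $X\times X$; for each $i$ the transpose of $R_i$ is $R_{i^*}$ for some index $i^*$; and for all $i,j,l$ the number $p_{i,j}^l=|\{z : (x,z)\in R_i,\ (z,y)\in R_j\}|$ is the same for all $(x,y)\in R_l$. It is commutative if $p_{i,j}^l=p_{j,i}^l$ for all $i,j,l$. Write $k_i=p_{i,i^*}^0$, call $R_i$ non-symmetric if $i\ne i^*$, and for sets $E,F$ of relations put $EF=\{R_l : p_{i,j}^l\neq 0 \text{ for some } R_i\in E,\ R_j\in F\}$, with $R_iR_j=\{R_i\}\{R_j\}$ and $R_i^2=R_iR_i$. A nonempty set $F$ of relations is closed if $R_{i^*}R_j\subseteq F$ for all $R_i,R_j\in F$, and $R_j$ generates $\mathfrak X$ if the smallest closed set containing $R_j$ is $\{R_0,\dots,R_d\}$. A commutative scheme $\mathfrak X$ is pseudocyclic if the primitive idempotents, other than $\frac1{|X|}J$ ($J$ the all-one matrix), of the complex algebra generated by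 the adjacency matrices of $R_0,\dots,R_d$ all have the same rank. Two schemes are isomorphic if some bijection between their point sets maps the relations of the first bijectively onto the relations of the second. For a primitive element $\alpha$ of $\mathrm{GF}(q)$ and a divisor $d$ of $q-1$, the scheme $\mathrm{Cyc}(q,d)$ on $\mathrm{GF}(q)$ has as relations the diagonal relation $R_0$ and $R_i=\{(x,y) : x-y\in\alpha^i\langle\alpha^d\rangle\}$ for $1\le i\le d$; up to isomorphism it does not depend on $\alpha$. **Theorem.** Let $\mathfrak X=(X,\{R_i\}_{i=0}^d)$ be a commutative association scheme generated by a non-symmetric relation $R_1$ and having a relation $R_2$ such that $$R_1^2\subseteq\{R_1,R_{1^*},R_2\},\qquad R_1R_{1^*}\subseteq\{R_0,R_1,R_{1^*},R_2,R_{2^*}\},\qquad 2\notin\{1^*,2^*\}.$$ If $k_1=k_2>1$, then $d=4$. If, moreover, $\mathfrak X$ is pseudocyclic, then $\mathfrak X$ is isomorphic to the cyclotomic scheme $\mathrm{Cyc}(13,4)$. -/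

import Mathlib

/-- A `d`-class association scheme on the finite set `X`, with relations `rel 0, …, rel d`.
The involution `star` and the intersection numbers `p i j l` (that is, `p_{i,j}^l`) are uniquely
determined by the relations. -/
structure AssociationScheme (X : Type*) [Fintype X] (d : ℕ) where
  /-- `rel i x y` means `(x, y) ∈ R_i`. -/
  rel : Fin (d + 1) → X → X → Prop
  /-- `R_{star i}` is the transpose of `R_i`. -/
  star : Fin (d + 1) → Fin (d + 1)
  /-- `p i j l` is the intersection number `p_{i,j}^l`. -/
  p : Fin (d + 1) → Fin (d + 1) → Fin (d + 1) → ℕ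
  rel_nonempty : ∀ i, ∃ x y, rel i x y
  rel_zero : ∀ x y, rel 0 x y ↔ x = y
  /-- The relations cover `X × X` and are pairwise disjoint. -/
  partition : ∀ x y, ∃! i, rel i x y
  rel_star : ∀ i x y, rel (star i) x y ↔ rel i y x
  /-- `|R_i(x) ∩ R_{j*}(y)| = p_{i,j}^l` for all `(x, y) ∈ R_l`. -/
  card_eq : ∀ i j l x y, rel l x y → {z | rel i x z ∧ rel (star j) y z}.ncard = p i j l

namespace AssociationScheme

variable {X : Type*} [Fintype X] {d : ℕ}

def IsCommutative (S : AssociationScheme X d) : Prop :=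
  ∀ i j l, S.p i j l = S.p j i l

/-- The valency `k_i = p_{i,i*}^0`. -/
def valency (S : AssociationScheme X d) (i : Fin (d + 1)) : ℕ :=
  S.p i (S.star i) 0

/-- The relation `R_i` is symmetric. -/
def IsSymmetricRelation (S : AssociationScheme X d) (i : Fin (d + 1)) : Prop :=
  i = S.star i

/-- The product `EF` of sets of relations; a relation is identified with its index. -/
def complexProduct (S : AssociationScheme X d) (E F : Finset (Fin (d + 1))) :
    Finset (Fin (d + 1)) :=
  Finset.univ.filter fun l => ∑ i ∈ E, ∑ j ∈ F, S.p i j l ≠ 0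

/-- A nonempty set `F` of relations is closed if `R_{i*} R_j ⊆ F` for all `R_i, R_j ∈ F`. -/
def IsClosedSubset (S : AssociationScheme X d) (F : Finset (Fin (d + 1))) : Prop :=
  F.Nonempty ∧ ∀ i ∈ F, ∀ j ∈ F, S.complexProduct {S.star i} {j} ⊆ F

/-- `R_j` generates the scheme: the smallest closed subset containing `R_j` consists of all the
relations. -/
def Generates (S : AssociationScheme X d) (j : Fin (d + 1)) : Prop :=
  IsLeast {F : Finset (Fin (d + 1)) | S.IsClosedSubset F ∧ j ∈ F} Finset.univ

open Classical in
/-- The adjacency matrix `A_i` of `R_i`. -/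
noncomputable def adjMatrix (S : AssociationScheme X d) (i : Fin (d + 1)) : Matrix X X ℂ :=
  Matrix.of fun x y => if S.rel i x y then 1 else 0

open Classical in
/-- The Bose-Mesner algebra, generated by the adjacency matrices over the complex field. -/
noncomputable def boseMesner (S : AssociationScheme X d) : Subalgebra ℂ (Matrix X X ℂ) :=
  Algebra.adjoin ℂ (Set.range S.adjMatrix)

/-- `E` is a primitive (that is, minimal nonzero) idempotent of the Bose-Mesner algebra. -/
def IsPrimitiveIdempotent (S : AssociationScheme X d) (E : Matrix X X ℂ) : Prop :=
  E ∈ S.boseMesner ∧ E ≠ 0 ∧ E * E = E ∧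
    ∀ F ∈ S.boseMesner, F * F = F → E * F = F → F * E = F → F = 0 ∨ F = E

/-- The trivial idempotent `E_0 = J / n`, where `n = |X|` and `J` is the all-one matrix. -/
noncomputable def trivialIdempotent (X : Type*) [Fintype X] : Matrix X X ℂ :=
  (Fintype.card X : ℂ)⁻¹ • Matrix.of fun _ _ => 1

/-- A commutative scheme is pseudocyclic if all its nontrivial multiplicities, i.e. the ranks of
the primitive idempotents other than `J / n`, coincide. -/
def IsPseudocyclic (S : AssociationScheme X d) : Prop :=
  S.IsCommutative ∧
    ∃ m : ℕ, ∀ E, S.IsPrimitiveIdempotent E → E ≠ trivialIdempotent X → E.rank = m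

/-- Two schemes are isomorphic if some bijection of the points maps the relations of the first
scheme bijectively onto the relations of the second. -/
def Isomorphic {Y : Type*} [Fintype Y] {e : ℕ} (S : AssociationScheme X d)
    (T : AssociationScheme Y e) : Prop :=
  ∃ (f : X ≃ Y) (σ : Fin (d + 1) ≃ Fin (e + 1)),
    ∀ i x y, S.rel i x y ↔ T.rel (σ i) (f x) (f y)

end AssociationScheme

namespace Cyclotomic

variable {K : Type*} [Field K] {d : ℕ}

/-- The cyclotomic relations: `R_0` is the diagonal relation and, for `1 ≤ i ≤ d`,
`(x, y) ∈ R_i` iff `x - y ∈ α ^ i ⟨α ^ d⟩`. -/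
def Rel (α : Kˣ) (d : ℕ) (i : Fin (d + 1)) (x y : K) : Prop :=
  if i = 0 then x = y
  else ∃ u ∈ Subgroup.zpowers (α ^ d), x - y = ((α ^ (i : ℕ) * u : Kˣ) : K)

theorem rel_zero (α : Kˣ) (x y : K) : Rel α d 0 x y ↔ x = y := by
  simp [Rel]

theorem rel_of_ne (α : Kˣ) {i : Fin (d + 1)} (hi : i ≠ 0) (x y : K) :
    Rel α d i x y ↔ ∃ u ∈ Subgroup.zpowers (α ^ d), x - y = ((α ^ (i : ℕ) * u : Kˣ) : K) := by
  simp [Rel, hi]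

theorem exists_class (α : Kˣ) (hα : ∀ x : Kˣ, x ∈ Subgroup.zpowers α) (hd : 0 < d) (v : Kˣ) :
    ∃ i : Fin (d + 1), i ≠ 0 ∧ ∃ u ∈ Subgroup.zpowers (α ^ d), v = α ^ (i : ℕ) * u := by
  obtain ⟨k, rfl⟩ := Subgroup.mem_zpowers_iff.1 (hα v)
  have hd' : (0 : ℤ) < d := by exact_mod_cast hd
  have h0 := Int.emod_nonneg (k - 1) hd'.ne'
  have h1 := Int.emod_lt_of_pos (k - 1) hd'
  have h2 := Int.emod_add_mul_ediv (k - 1) d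
  obtain ⟨r, hr⟩ := Int.eq_ofNat_of_zero_le h0
  refine ⟨⟨r + 1, by omega⟩, by simp [Fin.ext_iff], (α ^ d) ^ ((k - 1) / (d : ℤ)),
    Subgroup.zpow_mem_zpowers _ _, ?_⟩
  rw [← zpow_natCast α d, ← zpow_mul, ← zpow_natCast, ← zpow_add]
  congr 1
  push_cast
  linarith

theorem class_unique (α : Kˣ) [Fintype K] (hα : ∀ x : Kˣ, x ∈ Subgroup.zpowers α)
    (hd : d ∣ Fintype.card K - 1) {i j : Fin (d + 1)} (hi : i ≠ 0) (hj : j ≠ 0) {u w : Kˣ}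
    (hu : u ∈ Subgroup.zpowers (α ^ d)) (hw : w ∈ Subgroup.zpowers (α ^ d))
    (h : α ^ (i : ℕ) * u = α ^ (j : ℕ) * w) : i = j := by
  obtain ⟨a, rfl⟩ := Subgroup.mem_zpowers_iff.1 hu
  obtain ⟨b, rfl⟩ := Subgroup.mem_zpowers_iff.1 hw
  rw [← zpow_natCast α d, ← zpow_mul, ← zpow_mul, ← zpow_natCast, ← zpow_natCast, ← zpow_add,
    ← zpow_add, zpow_eq_zpow_iff_modEq, orderOf_eq_card_of_forall_mem_zpowers hα,
    Nat.card_units, Nat.card_eq_fintype_card] at h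
  have h' := (h.of_dvd (Int.natCast_dvd_natCast.2 hd)).dvd
  have h2 : (d : ℤ) ∣ (j : ℕ) - (i : ℕ) := by
    have e : ((j : ℕ) : ℤ) - (i : ℕ) = (((j : ℕ) : ℤ) + d * b - ((i : ℕ) + d * a)) - d * (b - a) := by
      ring
    rw [e]
    exact dvd_sub h' (dvd_mul_right _ _)
  have hi' : (i : ℕ) ≠ 0 := fun h => hi (Fin.ext h)
  have hj' : (j : ℕ) ≠ 0 := fun h => hj (Fin.ext h)
  have := Int.eq_zero_of_abs_lt_dvd h2 (by rw [abs_lt]; constructor <;> omega)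
  exact Fin.ext (by omega)

theorem d_pos [Fintype K] (hd : d ∣ Fintype.card K - 1) : 0 < d := by
  have := Fintype.one_lt_card (α := K)
  rcases Nat.eq_zero_or_pos d with rfl | h
  · rw [zero_dvd_iff] at hd
    omega
  · exact h

theorem partition (α : Kˣ) [Fintype K] (hα : ∀ x : Kˣ, x ∈ Subgroup.zpowers α)
    (hd : d ∣ Fintype.card K - 1) (x y : K) : ∃! i : Fin (d + 1), Rel α d i x y := by
  by_cases hxy : x = y
  · refine ⟨0, (rel_zero α x y).2 hxy, fun j hj => ?_⟩
    by_contra h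
    obtain ⟨u, -, hu⟩ := (rel_of_ne α h x y).1 hj
    rw [sub_eq_zero.2 hxy] at hu
    exact (Units.ne_zero _) hu.symm
  · obtain ⟨i, hi, u, hu, e⟩ := exists_class α hα (d_pos hd) (Units.mk0 _ (sub_ne_zero.2 hxy))
    refine ⟨i, (rel_of_ne α hi x y).2 ⟨u, hu, by rw [← e]; rfl⟩, fun j hj => ?_⟩
    by_cases h : j = 0
    · subst h
      exact absurd ((rel_zero α x y).1 hj) hxy
    · obtain ⟨w, hw, e'⟩ := (rel_of_ne α h x y).1 hj
      refine class_unique α hα hd h hi hw hu ?_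
      rw [← e]
      exact Units.ext e'.symm

/-- The relations are invariant under affine maps `z ↦ c z + b` with `c ∈ ⟨α ^ d⟩`. -/
theorem rel_affine (α : Kˣ) {c : Kˣ} (hc : c ∈ Subgroup.zpowers (α ^ d)) (b : K)
    (i : Fin (d + 1)) {x y : K} (h : Rel α d i x y) :
    Rel α d i ((c : K) * x + b) ((c : K) * y + b) := by
  by_cases hi : i = 0
  · subst hi
    rw [rel_zero] at h ⊢
    rw [h]
  · obtain ⟨u, hu, e⟩ := (rel_of_ne α hi x y).1 h
    refine (rel_of_ne α hi _ _).2 ⟨c * u, mul_mem hc hu, ?_⟩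
    push_cast at e ⊢
    linear_combination (c : K) * e

theorem exists_star (α : Kˣ) [Fintype K] (hα : ∀ x : Kˣ, x ∈ Subgroup.zpowers α)
    (hd : d ∣ Fintype.card K - 1) (i : Fin (d + 1)) :
    ∃ j : Fin (d + 1), ∀ x y : K, Rel α d j x y ↔ Rel α d i y x := by
  by_cases hi : i = 0
  · subst hi
    exact ⟨0, fun x y => by rw [rel_zero, rel_zero, eq_comm]⟩
  · obtain ⟨j, hj, w, hw, e⟩ := exists_class α hα (d_pos hd) (-α ^ (i : ℕ))
    have e' : -(α : K) ^ (i : ℕ) = (α : K) ^ (j : ℕ) * w := by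
      have := congrArg (Units.val) e
      simpa using this
    refine ⟨j, fun x y => ?_⟩
    rw [rel_of_ne α hj, rel_of_ne α hi]
    constructor
    · rintro ⟨u, hu, h⟩
      refine ⟨w⁻¹ * u, mul_mem (inv_mem hw) hu, ?_⟩
      push_cast at h ⊢
      have hw0 : (w : K) ≠ 0 := w.ne_zero
      field_simp
      linear_combination (-(w : K)) * h + (u : K) * e'
    · rintro ⟨u, hu, h⟩
      refine ⟨w * u, mul_mem hw hu, ?_⟩
      push_cast at h ⊢
      linear_combination -h + (u : K) * e'

/-- A representative of the class of index `i`, so that `(rep α i, 0) ∈ R_i`. -/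
def rep (α : Kˣ) (i : Fin (d + 1)) : K :=
  if i = 0 then 0 else (α : K) ^ (i : ℕ)

theorem rel_rep (α : Kˣ) (i : Fin (d + 1)) : Rel α d i (rep α i) 0 := by
  by_cases hi : i = 0
  · subst hi
    simp [Rel, rep]
  · exact (rel_of_ne α hi _ _).2 ⟨1, one_mem _, by simp [rep, hi]⟩

theorem exists_affine (α : Kˣ) {i : Fin (d + 1)} {x y x' y' : K} (h : Rel α d i x y)
    (h' : Rel α d i x' y') : ∃ c ∈ Subgroup.zpowers (α ^ d), ∃ b : K,
      (c : K) * x + b = x' ∧ (c : K) * y + b = y' := by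
  by_cases hi : i = 0
  · subst hi
    rw [rel_zero] at h h'
    subst h h'
    exact ⟨1, one_mem _, x' - x, by simp, by simp⟩
  · obtain ⟨u, hu, e⟩ := (rel_of_ne α hi x y).1 h
    obtain ⟨w, hw, e'⟩ := (rel_of_ne α hi x' y').1 h'
    refine ⟨w * u⁻¹, mul_mem hw (inv_mem hu), y' - ((w * u⁻¹ : Kˣ) : K) * y, ?_, by ring⟩
    have hu0 : (u : K) ≠ 0 := u.ne_zero
    push_cast at e e' ⊢
    field_simp
    linear_combination (w : K) * e - (u : K) * e'

theorem ncard_le (α : Kˣ) [Fintype K] {i j l : Fin (d + 1)} {x y x' y' : K}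
    (h : Rel α d l x y) (h' : Rel α d l x' y') :
    {z | Rel α d i x z ∧ Rel α d j y z}.ncard ≤ {z | Rel α d i x' z ∧ Rel α d j y' z}.ncard := by
  obtain ⟨c, hc, b, rfl, rfl⟩ := exists_affine α h h'
  refine Set.ncard_le_ncard_of_injOn (fun z => (c : K) * z + b) ?_ ?_ (Set.toFinite _)
  · rintro z ⟨h1, h2⟩
    exact ⟨rel_affine α hc b i h1, rel_affine α hc b j h2⟩
  · intro z _ z' _ e
    exact mul_left_cancel₀ c.ne_zero (add_right_cancel e)

end Cyclotomic

/-- The `d`-class cyclotomic scheme `Cyc(q, d)` over the finite field `K` with `q` elements, where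
`d` divides `q - 1` and `α` is a primitive element of `K`. -/
noncomputable def cyclotomicScheme {K : Type*} [Field K] [Fintype K] (α : Kˣ)
    (hα : ∀ x : Kˣ, x ∈ Subgroup.zpowers α) (d : ℕ) (hd : d ∣ Fintype.card K - 1) :
    AssociationScheme K d where
  rel := Cyclotomic.Rel α d
  star i := (Cyclotomic.exists_star α hα hd i).choose
  p i j l := {z | Cyclotomic.Rel α d i (Cyclotomic.rep α l) z ∧
    Cyclotomic.Rel α d (Cyclotomic.exists_star α hα hd j).choose 0 z}.ncard
  rel_nonempty i := ⟨_, _, Cyclotomic.rel_rep α i⟩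
  rel_zero := Cyclotomic.rel_zero α
  partition := Cyclotomic.partition α hα hd
  rel_star i := (Cyclotomic.exists_star α hα hd i).choose_spec
  card_eq _ _ l _ _ h := le_antisymm (Cyclotomic.ncard_le α h (Cyclotomic.rel_rep α l))
    (Cyclotomic.ncard_le α (Cyclotomic.rel_rep α l) h)

instance factPrimeThirteen : Fact (Nat.Prime 13) := ⟨by norm_num⟩

/-!
Write `A` and `B` for the adjacency matrices of `R_i` and `R_j` (in the theorem `i = 1`, `j = 2`),
and `k` for their common valency. The hypotheses say that
`A² = a A + b Aᵀ + c B` and `A Aᵀ = k I + a (A + Aᵀ) + f (B + Bᵀ)`, with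
`k = a + b + c = 1 + 2a + 2f`. Let `v` and `u` be the coefficients of `B` in `A B` and `A Bᵀ`.
Comparing coefficients in `(A A) Aᵀ = A (A Aᵀ)` gives `b² + c² = k + a² + 2f²`,
`c v = a c + f (v + u)`, `b c + c u = f (v' + v)` (with `v'` the coefficient of `Bᵀ` in `A B`), and
for every relation outside `F = {R_0, R_i, R_iᵀ, R_j, R_jᵀ}` a linear relation between the
coefficients of `A B` and `A Bᵀ`. If `c = 0` the latter coefficients vanish; the case `c < f` is
impossible. If `c > f`, row sums turn the equations into `(c - f) U = - c u k`, where `U ≥ 0` counts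
the part of `A Bᵀ` outside `F`, so that `u = U = 0`. If `c = f`, then `a = u = 0`, and either `v = 1`
and `U = 0`, or `v = 0` and `R_j` consists of tournaments without cyclic triangles; this is absurd
(`p_star_ne_zero_of_tournament`). If `f = 0`, then `R_i` consists of such tournaments, or `c = 0` and
`{R_0, R_i, R_iᵀ}` is closed (`SparseGenerator.p_mul_star_ne_zero`). Hence `F` is stable under multiplication by `R_i`,
so it contains all relations (`eq_univ_of_generates`), and `d = 4`; this is
`SparseGenerator.core_eq_univ_and`.

If the scheme is pseudocyclic, `∑ k_i⁻¹ A_i A_iᵀ` acts on a primitive idempotent `E` as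
`|X| / rank E`, so it is a combination of `I` and the all-one matrix
(`IsPseudocyclic.exists_normalizedSum_eq`; the decomposition of `I` into primitive idempotents comes
from the structure of reduced Artinian rings). For `d = 4` this gives `v = f`, which leaves only
`k = 3`, `a = 0`, `b = 2`, `c = f = 1` and `|X| = 13` (`SparseGenerator.intersection_numbers`).
The digraph `R_i` is then reconstructed arc by arc: starting from a point `0` and its out-neighbours
`1, 3, 9`, ordered cyclically by `R_j`, local counting produces labels in `ZMod 13` such that every
`u` has the out-neighbours `u + 1`, `u + 3`, `u + 9` (`IsThirteenDigraph.Labelling.arc`).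
Multiplication by `3` permutes the labels and reduces the number of arcs to be checked.
-/

namespace AssociationScheme
variable {X : Type*} [Fintype X] {d : ℕ} (S : AssociationScheme X d)

/-! ### Intersection numbers and adjacency matrices -/

theorem rel_unique {i j : Fin (d + 1)} {x y : X} (hi : S.rel i x y) (hj : S.rel j x y) : i = j :=
  (S.partition x y).unique hi hj

theorem exists_rel (x y : X) : ∃ i, S.rel i x y := (S.partition x y).exists

theorem star_star (i : Fin (d + 1)) : S.star (S.star i) = i := by
  obtain ⟨x, y, h⟩ := S.rel_nonempty i
  exact S.rel_unique (by rwa [S.rel_star, S.rel_star]) h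

theorem star_zero : S.star 0 = 0 := by
  obtain ⟨x, y, h⟩ := S.rel_nonempty 0
  refine S.rel_unique (x := x) (y := y) ?_ h
  rw [S.rel_star, S.rel_zero]
  exact ((S.rel_zero x y).1 h).symm

theorem star_eq_iff {i j : Fin (d + 1)} : S.star i = j ↔ i = S.star j :=
  ⟨fun h => by rw [← h, S.star_star], fun h => by rw [h, S.star_star]⟩

theorem star_injective : Function.Injective S.star := fun i j h => by
  rw [← S.star_star i, h, S.star_star]

theorem nonempty_points (S : AssociationScheme X d) : Nonempty X := ⟨(S.rel_nonempty 0).choose⟩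

theorem p_eq_ncard {i j l : Fin (d + 1)} {x y : X} (h : S.rel l x y) :
    S.p i j l = {z | S.rel i x z ∧ S.rel j z y}.ncard := by
  rw [← S.card_eq i j l x y h]
  simp only [S.rel_star]

theorem p_ne_zero_iff {i j l : Fin (d + 1)} {x y : X} (h : S.rel l x y) :
    S.p i j l ≠ 0 ↔ ∃ z, S.rel i x z ∧ S.rel j z y := by
  rw [S.p_eq_ncard h, Ne, Set.ncard_eq_zero (Set.toFinite _), ← Ne, ← Set.nonempty_iff_ne_empty]
  rfl

theorem p_ne_zero {i j l : Fin (d + 1)} {x y z : X} (h : S.rel l x y) (hi : S.rel i x z)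
    (hj : S.rel j z y) : S.p i j l ≠ 0 := (S.p_ne_zero_iff h).2 ⟨z, hi, hj⟩

open Classical in
theorem adjMatrix_apply (i : Fin (d + 1)) (x y : X) :
    S.adjMatrix i x y = if S.rel i x y then 1 else 0 := rfl

theorem adjMatrix_apply_of_rel {l : Fin (d + 1)} {x y : X} (h : S.rel l x y) (i : Fin (d + 1)) :
    S.adjMatrix i x y = if i = l then 1 else 0 := by
  rw [adjMatrix_apply]
  congr 1
  exact propext ⟨fun h' => S.rel_unique h' h, fun e => e ▸ h⟩

theorem sum_smul_adjMatrix_apply (q : Fin (d + 1) → ℂ) {l : Fin (d + 1)} {x y : X}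
    (h : S.rel l x y) : (∑ i, q i • S.adjMatrix i) x y = q l := by
  simp [Matrix.sum_apply, S.adjMatrix_apply_of_rel h]

theorem adjMatrix_star (i : Fin (d + 1)) : S.adjMatrix (S.star i) = (S.adjMatrix i).transpose := by
  ext x y
  rw [Matrix.transpose_apply, adjMatrix_apply, adjMatrix_apply, S.rel_star]

open Classical in
theorem adjMatrix_zero : S.adjMatrix 0 = 1 := by
  ext x y
  simp [adjMatrix_apply, S.rel_zero, Matrix.one_apply]

theorem adjMatrix_mul (i j : Fin (d + 1)) :
    S.adjMatrix i * S.adjMatrix j = ∑ l, (S.p i j l : ℂ) • S.adjMatrix l := by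
  classical
  ext x y
  obtain ⟨l, hl⟩ := S.exists_rel x y
  rw [S.sum_smul_adjMatrix_apply _ hl, S.p_eq_ncard hl, Matrix.mul_apply,
    Set.ncard_eq_toFinset_card']
  simp only [adjMatrix_apply, Finset.card_eq_sum_ones, Set.toFinset_ofPred, Finset.sum_filter]
  push_cast
  refine Finset.sum_congr rfl fun z _ => ?_
  by_cases h1 : S.rel i x z <;> by_cases h2 : S.rel j z y <;> simp [h1, h2]

theorem adjMatrix_mul_apply {l : Fin (d + 1)} {x y : X} (h : S.rel l x y) (i j : Fin (d + 1)) :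
    (S.adjMatrix i * S.adjMatrix j) x y = S.p i j l := by
  rw [adjMatrix_mul, S.sum_smul_adjMatrix_apply _ h]

theorem valency_eq_ncard (i : Fin (d + 1)) (x : X) : S.valency i = {z | S.rel i x z}.ncard := by
  rw [valency, S.p_eq_ncard ((S.rel_zero x x).2 rfl)]
  simp [S.rel_star]

theorem valency_zero : S.valency 0 = 1 := by
  obtain ⟨x⟩ := S.nonempty_points
  rw [S.valency_eq_ncard 0 x]
  simp [S.rel_zero]

theorem valency_pos (i : Fin (d + 1)) : 0 < S.valency i := by
  obtain ⟨x, y, h⟩ := S.rel_nonempty i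
  exact Nat.pos_of_ne_zero (S.p_ne_zero ((S.rel_zero x x).2 rfl) h ((S.rel_star i y x).2 h))

theorem p_zero {i j : Fin (d + 1)} (h : j ≠ S.star i) : S.p i j 0 = 0 := by
  obtain ⟨x⟩ := S.nonempty_points
  by_contra h0
  obtain ⟨z, h1, h2⟩ := (S.p_ne_zero_iff ((S.rel_zero x x).2 rfl)).1 h0
  exact h (S.rel_unique h2 ((S.rel_star _ _ _).2 h1))

theorem p_zero_right (i l : Fin (d + 1)) : S.p i 0 l = if i = l then 1 else 0 := by
  obtain ⟨x, y, h⟩ := S.rel_nonempty l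
  classical
  have := S.adjMatrix_mul_apply h i 0
  rw [adjMatrix_zero, mul_one, S.adjMatrix_apply_of_rel h] at this
  exact_mod_cast this.symm

theorem adjMatrix_mul_ones (i : Fin (d + 1)) :
    S.adjMatrix i * Matrix.of (fun _ _ : X => (1 : ℂ)) =
      (S.valency i : ℂ) • Matrix.of fun _ _ => 1 := by
  classical
  ext x y
  simp [Matrix.mul_apply, S.valency_eq_ncard i x, adjMatrix_apply, Set.ncard_eq_toFinset_card']

theorem sum_adjMatrix : ∑ i, S.adjMatrix i = Matrix.of fun _ _ => 1 := by
  ext x y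
  obtain ⟨l, hl⟩ := S.exists_rel x y
  simpa using S.sum_smul_adjMatrix_apply (fun _ => 1) hl

theorem sum_p_mul_valency (i j : Fin (d + 1)) :
    ∑ l, S.p i j l * S.valency l = S.valency i * S.valency j := by
  obtain ⟨x⟩ := S.nonempty_points
  have h := congrArg (fun M => (M * Matrix.of (fun _ _ : X => (1 : ℂ))) x x) (S.adjMatrix_mul i j)
  simp only [mul_assoc, adjMatrix_mul_ones, Finset.sum_mul, Matrix.smul_mul, Matrix.mul_smul,
    Matrix.sum_apply, Matrix.smul_apply, Matrix.of_apply, smul_eq_mul, mul_one] at h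
  rw [mul_comm]
  exact_mod_cast h.symm

theorem sum_valency : ∑ l, S.valency l = Fintype.card X := by
  classical
  obtain ⟨x⟩ := S.nonempty_points
  have h := congrArg (fun M => (M * Matrix.of (fun _ _ : X => (1 : ℂ))) x x) S.sum_adjMatrix
  simp only [adjMatrix_mul_ones, Finset.sum_mul] at h
  simp [Matrix.sum_apply, Matrix.mul_apply] at h
  exact_mod_cast h

theorem sum_p_mul_p (i j m l : Fin (d + 1)) :
    ∑ r, S.p i j r * S.p r m l = ∑ s, S.p i s l * S.p j m s := by
  obtain ⟨x, y, h⟩ := S.rel_nonempty l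
  have e := congrArg (fun M => M x y) (mul_assoc (S.adjMatrix i) (S.adjMatrix j) (S.adjMatrix m))
  simp only [S.adjMatrix_mul i j, S.adjMatrix_mul j m, Finset.sum_mul, Finset.mul_sum,
    Matrix.smul_mul, Matrix.mul_smul, Matrix.sum_apply, Matrix.smul_apply,
    S.adjMatrix_mul_apply h, smul_eq_mul] at e
  simp only [mul_comm (S.p i _ l)]
  exact_mod_cast e

theorem p_star (i j l : Fin (d + 1)) : S.p (S.star i) (S.star j) (S.star l) = S.p j i l := by
  obtain ⟨x, y, h⟩ := S.rel_nonempty l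
  rw [S.p_eq_ncard h, S.p_eq_ncard ((S.rel_star l y x).2 h)]
  simp only [S.rel_star, and_comm]

theorem valency_star (hc : S.IsCommutative) (i : Fin (d + 1)) :
    S.valency (S.star i) = S.valency i := by
  rw [valency, valency, hc, S.star_star]

theorem trace_adjMatrix (i : Fin (d + 1)) :
    (S.adjMatrix i).trace = if i = 0 then (Fintype.card X : ℂ) else 0 := by
  have h : ∀ x : X, S.adjMatrix i x x = if i = 0 then (1 : ℂ) else 0 := fun x =>
    S.adjMatrix_apply_of_rel ((S.rel_zero x x).2 rfl) i
  simp only [Matrix.trace, Matrix.diag_apply, h]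
  split_ifs <;> simp

theorem trace_adjMatrix_mul_star (i j : Fin (d + 1)) :
    (S.adjMatrix i * S.adjMatrix (S.star j)).trace =
      if i = j then (Fintype.card X * S.valency i : ℂ) else 0 := by
  rw [adjMatrix_mul, Matrix.trace_sum]
  simp only [Matrix.trace_smul, trace_adjMatrix, smul_eq_mul, mul_ite, mul_zero,
    Finset.sum_ite_eq', Finset.mem_univ, if_true]
  split_ifs with h
  · subst h
    rw [valency, mul_comm]
  · rw [S.p_zero fun e => h (S.star_injective e).symm]
    simp

theorem trace_triple (i j l : Fin (d + 1)) :
    (S.adjMatrix i * S.adjMatrix j * S.adjMatrix (S.star l)).trace =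
      Fintype.card X * (S.p i j l * S.valency l : ℕ) := by
  rw [adjMatrix_mul, Finset.sum_mul, Matrix.trace_sum]
  simp only [Matrix.smul_mul, Matrix.trace_smul, trace_adjMatrix_mul_star, smul_eq_mul, mul_ite,
    mul_zero, Finset.sum_ite_eq', Finset.mem_univ, if_true]
  push_cast
  ring

theorem p_mul_valency_left (i j l : Fin (d + 1)) :
    S.p i j l * S.valency l = S.p l (S.star j) i * S.valency i := by
  have := S.nonempty_points
  have hn : (Fintype.card X : ℂ) ≠ 0 := by exact_mod_cast Fintype.card_ne_zero
  have h : (Fintype.card X : ℂ) * (S.p i j l * S.valency l : ℕ) =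
      Fintype.card X * (S.p l (S.star j) i * S.valency i : ℕ) := by
    rw [← trace_triple, ← trace_triple, ← Matrix.trace_transpose]
    simp only [Matrix.transpose_mul, adjMatrix_star, Matrix.transpose_transpose, mul_assoc]
  exact_mod_cast mul_left_cancel₀ hn h

theorem p_mul_valency_right (hc : S.IsCommutative) (i j l : Fin (d + 1)) :
    S.p i j l * S.valency l = S.p (S.star i) l j * S.valency j := by
  rw [hc i j, p_mul_valency_left, hc l]

theorem p_mul_star_self (i : Fin (d + 1)) : S.p i (S.star i) i = S.p i i i :=
  (Nat.eq_of_mul_eq_mul_right (S.valency_pos i) (S.p_mul_valency_left i i i)).symm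

theorem p_mul_star_star (i l : Fin (d + 1)) :
    S.p i (S.star i) (S.star l) = S.p i (S.star i) l := by
  conv_lhs => rw [← S.star_star i, S.p_star, S.star_star]

/-! ### Generation and tournaments -/

theorem mem_complexProduct_singleton {i j l : Fin (d + 1)} :
    l ∈ S.complexProduct {i} {j} ↔ S.p i j l ≠ 0 := by
  simp [complexProduct]

/-- A transpose-closed set of relations that contains the diagonal and is stable under
multiplication by a generating relation consists of all relations: its stabilizer in the sense of
complex products is closed. -/
theorem eq_univ_of_generates {i : Fin (d + 1)} (hc : S.IsCommutative) (hgen : S.Generates i)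
    {F : Finset (Fin (d + 1))} (h0 : 0 ∈ F) (hstar : ∀ j ∈ F, S.star j ∈ F)
    (hF : ∀ j ∈ F, ∀ l, S.p i j l ≠ 0 → l ∈ F) : F = Finset.univ := by
  classical
  let G := Finset.univ.filter fun g => ∀ j ∈ F, ∀ l, S.p g j l ≠ 0 → l ∈ F
  have hG : ∀ g, g ∈ G ↔ ∀ j ∈ F, ∀ l, S.p g j l ≠ 0 → l ∈ F := fun g => by simp [G]
  have hGstar : ∀ g ∈ G, S.star g ∈ G := by
    intro g hg
    rw [hG] at hg ⊢
    intro j hj l hl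
    have := hg (S.star j) (hstar j hj) (S.star l) (by
      rwa [← S.star_star g, p_star, hc])
    simpa [S.star_star] using hstar _ this
  have hi : i ∈ G := (hG i).2 hF
  have huniv : Finset.univ ⊆ G := by
    refine hgen.2 ⟨⟨⟨i, hi⟩, fun g hg h hh r hr => ?_⟩, hi⟩
    rw [mem_complexProduct_singleton] at hr
    rw [hG]
    intro j hj l hl
    obtain ⟨x, y, hxy⟩ := S.rel_nonempty l
    obtain ⟨z, hxz, hzy⟩ := (S.p_ne_zero_iff hxy).1 hl
    obtain ⟨w, hxw, hwz⟩ := (S.p_ne_zero_iff hxz).1 hr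
    obtain ⟨t, ht⟩ := S.exists_rel w y
    exact (hG _).1 (hGstar g hg) t ((hG h).1 hh j hj t (S.p_ne_zero ht hwz hzy)) l
      (S.p_ne_zero hxy hxw ht)
  refine Finset.eq_univ_of_forall fun g => (hG g).1 (huniv (Finset.mem_univ g)) 0 h0 g ?_
  simp [p_zero_right]

/-- If the out-neighbourhoods of `R_i` are tournaments, then a transitive triangle forces a cyclic
one: otherwise `R_i` would order every out-neighbourhood linearly without a maximal element. -/
theorem p_star_ne_zero_of_tournament {i : Fin (d + 1)} (hc : S.IsCommutative)
    (h : ∀ l, S.p i (S.star i) l ≠ 0 → l = 0 ∨ l = i ∨ l = S.star i)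
    (hpos : S.p i i i ≠ 0) (hi : S.star i ≠ i) : S.p i i (S.star i) ≠ 0 := by
  intro hzero
  obtain ⟨x, y₀, hxy₀⟩ := S.rel_nonempty i
  have hcyc : ∀ {x y z : X}, S.rel i x y → S.rel i y z → ¬ S.rel i z x := fun h1 h2 h3 =>
    S.p_ne_zero ((S.rel_star i _ _).2 h3) h1 h2 hzero
  have hirr : ∀ {x y : X}, S.rel i x y → ¬ S.rel i y x := fun h1 h2 =>
    hi (S.rel_unique ((S.rel_star i _ _).2 h2) h1)
  let N := {y // S.rel i x y}
  have htrans : ∀ u v w : N, S.rel i u.1 v.1 → S.rel i v.1 w.1 → S.rel i u.1 w.1 := by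
    intro u v w huv hvw
    obtain ⟨l, hl⟩ := S.exists_rel u.1 w.1
    have := h l (by
      rw [hc]
      exact S.p_ne_zero hl ((S.rel_star _ _ _).2 u.2) w.2)
    rcases this with rfl | rfl | rfl
    · rw [(S.rel_zero _ _).1 hl] at huv
      exact absurd hvw (hirr huv)
    · exact hl
    · exact absurd ((S.rel_star _ _ _).1 hl) (hcyc huv hvw)
  have hnext : ∀ u : N, ∃ v : N, S.rel i u.1 v.1 := by
    intro u
    have hp : S.p i (S.star i) i ≠ 0 := by rwa [S.p_mul_star_self]
    obtain ⟨z, h1, h2⟩ := (S.p_ne_zero_iff u.2).1 hp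
    exact ⟨⟨z, h1⟩, (S.rel_star _ _ _).1 h2⟩
  let r : N → N → Prop := fun u v => S.rel i v.1 u.1
  have : IsTrans N r := ⟨fun a b c hab hbc => htrans c b a hbc hab⟩
  have : Std.Irrefl r := ⟨fun a haa => hirr haa haa⟩
  obtain ⟨m, -, hm⟩ := (Finite.wellFounded_of_trans_of_irrefl r).has_min Set.univ
    ⟨⟨y₀, hxy₀⟩, trivial⟩
  obtain ⟨v, hv⟩ := hnext m
  exact hm v trivial hv

/-! ### Schemes with a sparse generator -/

/-- `R_i` is a non-symmetric relation that generates a commutative scheme, its products with itself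
and its transpose involve only `R_0`, `R_i`, `R_j` and their transposes, and `R_i` and `R_j` have
the same valency. -/
structure SparseGenerator (i j : Fin (d + 1)) : Prop where
  comm : S.IsCommutative
  generates : S.Generates i
  star_ne : S.star i ≠ i
  star_ne' : S.star j ≠ j
  ne : j ≠ i
  ne_star : j ≠ S.star i
  sq : ∀ l, S.p i i l ≠ 0 → l = i ∨ l = S.star i ∨ l = j
  mul_star : ∀ l, S.p i (S.star i) l ≠ 0 →
    l = 0 ∨ l = i ∨ l = S.star i ∨ l = j ∨ l = S.star j
  valency_eq : S.valency j = S.valency i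

end AssociationScheme

namespace AssociationScheme
variable {X : Type*} [Fintype X] {d : ℕ} {S : AssociationScheme X d}

/-- The relations `R_0`, `R_i`, `R_j` and their transposes. -/
def core (S : AssociationScheme X d) (i j : Fin (d + 1)) : Finset (Fin (d + 1)) :=
  {0, i, S.star i, j, S.star j}

theorem mem_core {i j l : Fin (d + 1)} :
    l ∈ S.core i j ↔ l = 0 ∨ l = i ∨ l = S.star i ∨ l = j ∨ l = S.star j := by
  simp [core]

namespace SparseGenerator

variable {i j : Fin (d + 1)}

theorem zero_ne (h : S.SparseGenerator i j) : 0 ≠ i ∧ 0 ≠ S.star i ∧ 0 ≠ j ∧ 0 ≠ S.star j := by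
  have h1 : 0 ≠ i := fun e => h.star_ne (by rw [← e, S.star_zero])
  have h2 : 0 ≠ j := fun e => h.star_ne' (by rw [← e, S.star_zero])
  refine ⟨h1, fun e => h1 ?_, h2, fun e => h2 ?_⟩
  · rw [← S.star_star i, ← e, S.star_zero]
  · rw [← S.star_star j, ← e, S.star_zero]

theorem star_ne_star (h : S.SparseGenerator i j) : S.star j ≠ S.star i := fun e =>
  h.ne (S.star_injective e)

theorem star_ne_left (h : S.SparseGenerator i j) : S.star j ≠ i := fun e =>
  h.ne_star (S.star_eq_iff.1 e)

theorem sum_sq_mul (h : S.SparseGenerator i j) (g : Fin (d + 1) → ℕ) :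
    ∑ l, S.p i i l * g l =
      S.p i i i * g i + S.p i i (S.star i) * g (S.star i) + S.p i i j * g j := by
  rw [← Finset.sum_subset (Finset.subset_univ {i, S.star i, j})]
  · rw [Finset.sum_insert, Finset.sum_insert, Finset.sum_singleton, add_assoc]
    · simpa using h.ne_star.symm
    · simpa using ⟨h.star_ne.symm, h.ne.symm⟩
  · intro l _ hl
    have : S.p i i l = 0 := by
      by_contra h0
      have := h.sq l h0
      simp at hl
      tauto
    rw [this, zero_mul]

/-- Sums over the five relations known explicitly, and over the remaining ones. -/
theorem sum_eq (h : S.SparseGenerator i j) (g : Fin (d + 1) → ℕ) :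
    ∑ l, g l = g 0 + g i + g (S.star i) + g j + g (S.star j) +
      ∑ l ∈ (S.core i j)ᶜ, g l := by
  rw [← Finset.sum_add_sum_compl (S.core i j)]
  obtain ⟨h1, h2, h3, h4⟩ := h.zero_ne
  congr 1
  rw [core, Finset.sum_insert, Finset.sum_insert, Finset.sum_insert, Finset.sum_insert,
    Finset.sum_singleton]
  · ring
  · simpa using h.star_ne'.symm
  · simpa using ⟨h.ne_star.symm, h.star_ne_star.symm⟩
  · simpa using ⟨h.star_ne.symm, h.ne.symm, h.star_ne_left.symm⟩
  · simpa using ⟨h1, h2, h3, h4⟩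

theorem sum_mul_star_mul (h : S.SparseGenerator i j) (g : Fin (d + 1) → ℕ) :
    ∑ l, S.p i (S.star i) l * g l = S.valency i * g 0 + S.p i i i * (g i + g (S.star i)) +
      S.p i (S.star i) j * (g j + g (S.star j)) := by
  rw [h.sum_eq, Finset.sum_eq_zero, S.p_mul_star_star, S.p_mul_star_star, S.p_mul_star_self, valency]
  · ring
  · intro l hl
    have : S.p i (S.star i) l = 0 := by
      by_contra h0
      exact Finset.mem_compl.1 hl (mem_core.2 (h.mul_star l h0))
    rw [this, zero_mul]

theorem valency_star_left (h : S.SparseGenerator i j) : S.valency (S.star i) = S.valency i :=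
  S.valency_star h.comm i

theorem valency_star_right (h : S.SparseGenerator i j) : S.valency (S.star j) = S.valency i := by
  rw [S.valency_star h.comm, h.valency_eq]

theorem valency_eq_sq (h : S.SparseGenerator i j) :
    S.valency i = S.p i i i + S.p i i (S.star i) + S.p i i j := by
  have e := S.sum_p_mul_valency i i
  rw [h.sum_sq_mul, h.valency_star_left, h.valency_eq, ← add_mul, ← add_mul] at e
  exact (Nat.eq_of_mul_eq_mul_right (S.valency_pos i) e).symm

theorem valency_eq_mul_star (h : S.SparseGenerator i j) :
    S.valency i = 1 + 2 * S.p i i i + 2 * S.p i (S.star i) j := by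
  have e := S.sum_p_mul_valency i (S.star i)
  rw [h.sum_mul_star_mul, h.valency_star_left, h.valency_star_right, h.valency_eq,
    S.valency_zero] at e
  refine Nat.eq_of_mul_eq_mul_right (S.valency_pos i) ?_
  rw [← e]
  ring

theorem p_mul_right_star (h : S.SparseGenerator i j) : S.p i (S.star j) i = S.p i (S.star i) j := by
  have e := S.p_mul_valency_right h.comm i (S.star j) i
  rw [h.valency_star_right] at e
  rw [Nat.eq_of_mul_eq_mul_right (S.valency_pos i) e, h.comm, S.p_mul_star_star]

theorem p_mul_right (h : S.SparseGenerator i j) : S.p i j i = S.p i (S.star i) j := by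
  rw [Nat.eq_of_mul_eq_mul_right (S.valency_pos i) (S.p_mul_valency_left i j i),
    h.p_mul_right_star]

theorem p_mul_right_star_star (h : S.SparseGenerator i j) :
    S.p i (S.star j) (S.star i) = S.p i i j := by
  have e := S.p_mul_valency_right h.comm i (S.star j) (S.star i)
  rw [h.valency_star_right, h.valency_star_left] at e
  rw [Nat.eq_of_mul_eq_mul_right (S.valency_pos i) e, S.p_star]

theorem p_mul_right_star_left (h : S.SparseGenerator i j) : S.p i j (S.star i) = 0 := by
  have e := S.p_mul_valency_right h.comm i j (S.star i)
  rw [h.valency_eq, h.valency_star_left] at e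
  rw [Nat.eq_of_mul_eq_mul_right (S.valency_pos i) e, ← S.star_star j, S.p_star]
  by_contra h0
  rcases h.sq _ h0 with e | e | e
  · exact h.star_ne_left e
  · exact h.star_ne_star e
  · exact h.star_ne' e

theorem p_mul_right_star_right (h : S.SparseGenerator i j) :
    S.p i (S.star j) (S.star j) = S.p i j j := by
  have e1 := S.p_mul_valency_left i (S.star j) (S.star j)
  have e2 := S.p_mul_valency_left i j j
  rw [h.valency_star_right] at e1
  rw [h.valency_eq] at e2
  rw [Nat.eq_of_mul_eq_mul_right (S.valency_pos i) e1,
    Nat.eq_of_mul_eq_mul_right (S.valency_pos i) e2, h.comm, S.star_star]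

/-- `p_{j,i*}^l` is the coefficient of the transpose of `R_l` in the product of `R_i` and the
transpose of `R_j`. -/
theorem p_star_mul (h : S.SparseGenerator i j) (l : Fin (d + 1)) :
    S.p (S.star i) j l = S.p i (S.star j) (S.star l) := by
  have := S.p_star i (S.star j) (S.star l)
  rw [S.star_star, S.star_star] at this
  rw [this, h.comm]

/-- Associativity, applied to the product of `R_i`, `R_i` and the transpose of `R_i`. -/
theorem assoc_star (h : S.SparseGenerator i j) (l : Fin (d + 1)) :
    S.p i i i * S.p i (S.star i) l + S.p i i (S.star i) * S.p i i (S.star l) +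
        S.p i i j * S.p i (S.star j) (S.star l) =
      S.valency i * (if i = l then 1 else 0) +
        S.p i i i * (S.p i i l + S.p i (S.star i) l) +
        S.p i (S.star i) j * (S.p i j l + S.p i (S.star j) l) := by
  have e := S.sum_p_mul_p i i (S.star i) l
  simp only [mul_comm (S.p i _ l)] at e
  rw [h.sum_sq_mul, h.sum_mul_star_mul fun s => S.p i s l, S.p_zero_right] at e
  rw [← e, h.comm j, h.p_star_mul, ← S.p_star i i (S.star l), S.star_star]

/-- Associativity, applied to the product of `R_i`, `R_i` and `R_j`. -/
theorem assoc_right (h : S.SparseGenerator i j) (l : Fin (d + 1)) :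
    S.p i i i * S.p i j l + S.p i i (S.star i) * S.p i (S.star j) (S.star l) +
        S.p i i j * S.p j j l = ∑ s, S.p i j s * S.p i s l := by
  have e := S.sum_p_mul_p i i j l
  simp only [mul_comm (S.p i _ l)] at e
  rw [h.sum_sq_mul] at e
  rw [← e, h.p_star_mul]

/-! ### The scheme has four classes -/

theorem p_sq_star (h : S.SparseGenerator i j) : S.p i i (S.star j) = 0 := by
  by_contra h0
  rcases h.sq _ h0 with e | e | e
  · exact h.star_ne_left e
  · exact h.star_ne_star e
  · exact h.star_ne' e

theorem sq_add_sq (h : S.SparseGenerator i j) :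
    S.p i i (S.star i) ^ 2 + S.p i i j ^ 2 =
      S.valency i + S.p i i i ^ 2 + 2 * S.p i (S.star i) j ^ 2 := by
  have e := h.assoc_star i
  rw [S.p_mul_star_self, h.p_mul_right_star_star, h.p_mul_right, h.p_mul_right_star,
    if_pos rfl] at e
  linarith

theorem mul_p_right (h : S.SparseGenerator i j) :
    S.p i i j * S.p i j j =
      S.p i i i * S.p i i j + S.p i (S.star i) j * (S.p i j j + S.p i (S.star j) j) := by
  have e := h.assoc_star j
  rw [h.p_sq_star, h.p_mul_right_star_right, if_neg h.ne.symm] at e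
  linarith

theorem mul_p_right_star (h : S.SparseGenerator i j) :
    S.p i i (S.star i) * S.p i i j + S.p i i j * S.p i (S.star j) j =
      S.p i (S.star i) j * (S.p i j (S.star j) + S.p i j j) := by
  have e := h.assoc_star (S.star j)
  rw [h.p_sq_star, h.p_mul_right_star_right, if_neg h.star_ne_left.symm, S.star_star,
    S.p_mul_star_star] at e
  linarith

theorem mul_p_of_not_mem (h : S.SparseGenerator i j) {l : Fin (d + 1)} (hl : l ∉ S.core i j) :
    S.p i i j * S.p i (S.star j) (S.star l) =
      S.p i (S.star i) j * (S.p i j l + S.p i (S.star j) l) := by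
  have e := h.assoc_star l
  have h1 : S.p i (S.star i) l = 0 := by
    by_contra h0
    exact hl (mem_core.2 (h.mul_star l h0))
  have h2 : S.p i i l = 0 := by
    by_contra h0
    have := h.sq l h0
    exact hl (mem_core.2 (by tauto))
  have h3 : S.p i i (S.star l) = 0 := by
    by_contra h0
    have := h.sq _ h0
    rw [S.star_eq_iff, S.star_eq_iff, S.star_eq_iff, S.star_star] at this
    exact hl (mem_core.2 (by tauto))
  have h4 : i ≠ l := fun e => hl (mem_core.2 (by tauto))
  rw [h1, h2, h3, if_neg h4] at e
  linarith

/-- Row sums of the product of `R_i` and `R_j`. -/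
theorem sum_p_right (h : S.SparseGenerator i j) :
    (S.p i (S.star i) j + S.p i j j + S.p i j (S.star j)) * S.valency i +
      ∑ l ∈ (S.core i j)ᶜ, S.p i j l * S.valency l = S.valency i * S.valency i := by
  have e := S.sum_p_mul_valency i j
  rw [h.sum_eq, S.p_zero h.ne_star, h.p_mul_right, h.p_mul_right_star_left, h.valency_eq,
    h.valency_star_right] at e
  linarith

/-- Row sums of the product of `R_i` and the transpose of `R_j`. -/
theorem sum_p_right_star (h : S.SparseGenerator i j) :
    (S.p i (S.star i) j + S.p i i j + S.p i (S.star j) j + S.p i j j) * S.valency i +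
      ∑ l ∈ (S.core i j)ᶜ, S.p i (S.star j) l * S.valency l = S.valency i * S.valency i := by
  have e := S.sum_p_mul_valency i (S.star j)
  rw [h.sum_eq, S.p_zero h.star_ne_star, h.p_mul_right_star, h.p_mul_right_star_star,
    h.p_mul_right_star_right, h.valency_eq, h.valency_star_right, h.valency_star_left] at e
  linarith

theorem sum_p_star_right (h : S.SparseGenerator i j) :
    (S.p i (S.star i) j + S.p i i j + S.p i (S.star j) j + S.p i j j) * S.valency i +
      ∑ l ∈ (S.core i j)ᶜ, S.p i (S.star j) (S.star l) * S.valency l =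
        S.valency i * S.valency i := by
  have e := S.sum_p_mul_valency (S.star i) j
  simp only [h.p_star_mul] at e
  rw [h.sum_eq, S.star_zero, S.p_zero h.star_ne_star, S.star_star, S.star_star, h.p_mul_right_star,
    h.p_mul_right_star_star, h.p_mul_right_star_right, h.valency_eq, h.valency_star_right,
    h.valency_star_left] at e
  linarith

theorem sum_compl (h : S.SparseGenerator i j) :
    S.p i i j * ∑ l ∈ (S.core i j)ᶜ, S.p i (S.star j) l * S.valency l =
      S.p i (S.star i) j * (∑ l ∈ (S.core i j)ᶜ, S.p i j l * S.valency l +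
        ∑ l ∈ (S.core i j)ᶜ, S.p i (S.star j) l * S.valency l) := by
  have e : ∑ l ∈ (S.core i j)ᶜ, S.p i (S.star j) l * S.valency l =
      ∑ l ∈ (S.core i j)ᶜ, S.p i (S.star j) (S.star l) * S.valency l :=
    Nat.add_left_cancel (h.sum_p_right_star.trans h.sum_p_star_right.symm)
  nth_rw 1 [e]
  rw [← Finset.sum_add_distrib, Finset.mul_sum, Finset.mul_sum]
  refine Finset.sum_congr rfl fun l hl => ?_
  rw [← mul_assoc, h.mul_p_of_not_mem (Finset.mem_compl.1 hl)]
  ring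

theorem p_eq_zero_of_sum_eq_zero {m : Fin (d + 1)}
    (hs : ∑ l ∈ (S.core i j)ᶜ, S.p i m l * S.valency l = 0) {l : Fin (d + 1)}
    (hl : l ∉ S.core i j) : S.p i m l = 0 := by
  have := Finset.sum_eq_zero_iff.1 hs l (Finset.mem_compl.2 hl)
  exact (Nat.mul_eq_zero.1 this).resolve_right (S.valency_pos l).ne'

theorem core_eq_univ (h : S.SparseGenerator i j) (hv : ∀ l ∉ S.core i j, S.p i j l = 0)
    (hu : ∀ l ∉ S.core i j, S.p i (S.star j) l = 0) : S.core i j = Finset.univ := by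
  refine S.eq_univ_of_generates h.comm h.generates (mem_core.2 (Or.inl rfl)) ?_ ?_
  · intro m hm
    rw [mem_core] at hm ⊢
    rw [S.star_eq_iff, S.star_eq_iff, S.star_eq_iff, S.star_eq_iff, S.star_eq_iff, S.star_star,
      S.star_star, S.star_zero]
    tauto
  · intro m hm l hl
    rcases mem_core.1 hm with rfl | rfl | rfl | rfl | rfl
    · rw [S.p_zero_right] at hl
      exact mem_core.2 (Or.inr (Or.inl (by by_contra e; simp [Ne.symm e] at hl)))
    · have := h.sq l hl
      exact mem_core.2 (by tauto)
    · exact mem_core.2 (h.mul_star l hl)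
    · by_contra e
      exact hl (hv l e)
    · by_contra e
      exact hl (hu l e)

theorem d_eq_four_of_core_eq_univ (h : S.SparseGenerator i j) (hF : S.core i j = Finset.univ) :
    d = 4 := by
  have e := h.sum_eq fun _ => 1
  rw [hF] at e
  simp at e
  exact e

/-- If no two out-neighbours in `R_i` of a point are in relation `R_j`, then `R_i` consists of
tournaments or `R_0`, `R_i` and its transpose form a closed set. -/
theorem p_mul_star_ne_zero (h : S.SparseGenerator i j) (hk : S.valency i ≠ 1) :
    S.p i (S.star i) j ≠ 0 := by
  intro hf
  have hmul : ∀ l, S.p i (S.star i) l ≠ 0 → l = 0 ∨ l = i ∨ l = S.star i := by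
    intro l hl
    rcases h.mul_star l hl with e | e | e | e | e
    · exact Or.inl e
    · exact Or.inr (Or.inl e)
    · exact Or.inr (Or.inr e)
    · exact absurd hf (e ▸ hl)
    · rw [e, S.p_mul_star_star] at hl
      exact absurd hf hl
  by_cases hc : S.p i i j = 0
  · have huniv := S.eq_univ_of_generates (F := {0, i, S.star i}) h.comm h.generates (by simp)
      (fun m hm => by
        simp only [Finset.mem_insert, Finset.mem_singleton] at hm ⊢
        rcases hm with rfl | rfl | rfl
        · exact Or.inl S.star_zero
        · exact Or.inr (Or.inr rfl)
        · exact Or.inr (Or.inl (S.star_star _)))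
      (fun m hm l hl => by
        simp only [Finset.mem_insert, Finset.mem_singleton] at hm ⊢
        rcases hm with rfl | rfl | rfl
        · rw [S.p_zero_right] at hl
          exact Or.inr (Or.inl (by by_contra e; simp [Ne.symm e] at hl))
        · rcases h.sq l hl with e | e | e
          · exact Or.inr (Or.inl e)
          · exact Or.inr (Or.inr e)
          · exact absurd hc (e ▸ hl)
        · exact hmul l hl)
    have hj : j ∈ ({0, i, S.star i} : Finset (Fin (d + 1))) := huniv ▸ Finset.mem_univ j
    simp only [Finset.mem_insert, Finset.mem_singleton] at hj
    rcases hj with e | e | e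
    · exact h.zero_ne.2.2.1 e.symm
    · exact h.ne e
    · exact h.ne_star e
  · have hk' := h.valency_eq_mul_star
    refine S.p_star_ne_zero_of_tournament h.comm hmul ?_ h.star_ne ?_
    · intro ha
      rw [hf, ha] at hk'
      exact hk hk'
    · have e := h.mul_p_right_star
      rw [hf, zero_mul, ← mul_comm (S.p i i j), ← mul_add] at e
      have := (Nat.mul_eq_zero.1 e).resolve_left hc
      omega

/-- If `R_i` squared and the product of `R_i` with its transpose contain `R_j` equally often, then
`R_j` occurs in its product with `R_i`; otherwise `R_j` would consist of tournaments without cyclic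
triangles. -/
theorem p_right_ne_zero (h : S.SparseGenerator i j) (hf : S.p i i j ≠ 0)
    (hcf : S.p i i j = S.p i (S.star i) j) (ha : S.p i i i = 0) (hu : S.p i (S.star j) j = 0)
    (hV : ∀ l ∉ S.core i j, S.p i j l = 0) : S.p i j j ≠ 0 := by
  intro hv
  have e3 := h.mul_p_right_star
  have e5 := h.valency_eq_mul_star
  rw [hu, hv, ← hcf, mul_zero, add_zero, add_zero, mul_comm] at e3
  have hb := Nat.eq_of_mul_eq_mul_left (Nat.pos_of_ne_zero hf) e3
  have key : ∀ l, S.p i i (S.star i) * S.p i (S.star j) (S.star l) + S.p i i j * S.p j j l =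
      S.p i i j * S.p i i l + S.p i i (S.star i) * S.p i (S.star j) l := by
    intro l
    have e := h.assoc_right l
    rw [h.sum_eq, Finset.sum_eq_zero fun m hm => by rw [hV m (Finset.mem_compl.1 hm), zero_mul],
      S.p_zero h.ne_star, h.p_mul_right, h.p_mul_right_star_left, hv, ha, ← hb, ← hcf] at e
    linarith
  have hj : S.p j j j = S.p i i j := by
    have e := key j
    rw [hu, h.p_mul_right_star_right, hv] at e
    exact Nat.eq_of_mul_eq_mul_left (Nat.pos_of_ne_zero hf) (by linarith)
  have hj' : S.p j j (S.star j) = 0 := by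
    have e := key (S.star j)
    rw [S.star_star, hu, h.p_mul_right_star_right, hv, h.p_sq_star] at e
    exact (Nat.mul_eq_zero.1 (by linarith : S.p i i j * S.p j j (S.star j) = 0)).resolve_left hf
  refine S.p_star_ne_zero_of_tournament h.comm (fun l hl => ?_) (hj ▸ hf) h.star_ne' hj'
  have hs := S.sum_p_mul_valency j (S.star j)
  rw [← Finset.sum_add_sum_compl {0, j, S.star j}, Finset.sum_insert, Finset.sum_insert,
    Finset.sum_singleton, S.p_mul_star_star, S.p_mul_star_self, hj, h.valency_star_right,
    h.valency_eq, S.valency_zero, ← valency, h.valency_eq] at hs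
  · have hz : ∑ l ∈ ({0, j, S.star j} : Finset (Fin (d + 1)))ᶜ,
        S.p j (S.star j) l * S.valency l = 0 := by
      rw [ha, ← hcf] at e5
      nlinarith
    by_contra hl'
    have := Finset.sum_eq_zero_iff.1 hz l (by simpa using hl')
    exact hl ((Nat.mul_eq_zero.1 this).resolve_right (S.valency_pos l).ne')
  · simpa using h.star_ne'.symm
  · simpa using ⟨h.zero_ne.2.2.1, h.zero_ne.2.2.2⟩

/-- The two ways of counting combine to `(c - f) U = - c u k`, where both sides have opposite
signs. -/
theorem eq_zero_of_lt {a b c f k u v U : ℕ} (e1 : b ^ 2 + c ^ 2 = k + a ^ 2 + 2 * f ^ 2)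
    (e2 : c * v = a * c + f * (v + u)) (e4 : k = a + b + c) (e5 : k = 1 + 2 * a + 2 * f)
    (e7 : (f + c + u + v) * k + U = k * k) (hfc : f < c) : u = 0 ∧ U = 0 := by
  have hk : 0 < k := by omega
  zify at e1 e2 e4 e5 e7 hfc
  have hb : (b : ℤ) = 1 + a + 2 * f - c := by linarith
  rw [hb, e5] at e1
  have key : (c - f : ℤ) * U + c * u * k = 0 := by
    have e7' : (U : ℤ) = k * (k - (f + c + u + v)) := by linarith
    rw [e7']
    have : (c - f : ℤ) * (k - (f + c + u + v)) + c * u = 0 := by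
      have : 2 * ((c - f : ℤ) * (k - (f + c + u + v)) + c * u) = 0 := by
        rw [e5]
        linear_combination -2 * e2 - e1
      linarith
    linear_combination (k : ℤ) * this
  have h1 : 0 ≤ (c - f : ℤ) * U := mul_nonneg (by linarith) (by positivity)
  have h2 : 0 ≤ (c * u * k : ℤ) := by positivity
  have h3 : (c - f : ℤ) * U = 0 := by linarith
  have h4 : (c * u * k : ℤ) = 0 := by linarith
  constructor
  · have : c * u * k = 0 := by exact_mod_cast h4
    rcases Nat.mul_eq_zero.1 this with h | h
    · exact (Nat.mul_eq_zero.1 h).resolve_left (by omega)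
    · omega
  · rcases mul_eq_zero.1 h3 with h | h
    · omega
    · exact_mod_cast h

/-- Write `c`, `f`, `u`, `v` for the multiplicities of `R_j` in `R_i R_i`, in `R_i` times its
transpose, in `R_i` times the transpose of `R_j`, and in `R_i R_j`. There are no further relations,
and `c = 0`, or `c = f` and `v = 1`, or `c > f` and `u = 0`. -/
theorem core_eq_univ_and (h : S.SparseGenerator i j) (hk : S.valency i ≠ 1) :
    S.core i j = Finset.univ ∧ (S.p i i j = 0 ∨
      (S.p i i j = S.p i (S.star i) j ∧ S.p i i i = 0 ∧ S.p i j j = 1) ∨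
      S.p i (S.star i) j < S.p i i j ∧ S.p i (S.star j) j = 0) := by
  have hf := h.p_mul_star_ne_zero hk
  have e1 := h.sq_add_sq
  have e2 := h.mul_p_right
  have e4 := h.valency_eq_sq
  have e5 := h.valency_eq_mul_star
  have e6 := h.sum_p_right
  have e7 := h.sum_p_right_star
  have e8 := h.sum_compl
  have hfpos := Nat.pos_of_ne_zero hf
  by_cases hc : S.p i i j = 0
  · have hother : ∀ l ∉ S.core i j, S.p i j l = 0 ∧ S.p i (S.star j) l = 0 := by
      intro l hl
      have e := h.mul_p_of_not_mem hl
      rw [hc, zero_mul] at e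
      have := (Nat.mul_eq_zero.1 e.symm).resolve_left hf
      omega
    exact ⟨h.core_eq_univ (fun l hl => (hother l hl).1) fun l hl => (hother l hl).2, Or.inl hc⟩
  have hcpos := Nat.pos_of_ne_zero hc
  rcases lt_trichotomy (S.p i i j) (S.p i (S.star i) j) with hlt | heq | hgt
  · exfalso
    have ha : S.p i i i = 0 := by
      have : S.p i i i * S.p i i j = 0 := by nlinarith
      exact (Nat.mul_eq_zero.1 this).resolve_right hc
    rw [ha] at e1 e4 e5
    have hb : S.p i i (S.star i) = 1 + 2 * S.p i (S.star i) j - S.p i i j := by omega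
    zify at e1 e5 hlt
    rw [hb, Nat.cast_sub (by omega), e5] at e1
    push_cast at e1
    nlinarith
  · have h0 : S.p i i i * S.p i i j + S.p i i j * S.p i (S.star j) j = 0 := by
      rw [heq] at e2 ⊢
      linarith
    have ha : S.p i i i = 0 := (Nat.mul_eq_zero.1 (by omega)).resolve_right hc
    have hu : S.p i (S.star j) j = 0 :=
      (Nat.mul_eq_zero.1 (by omega : S.p i i j * S.p i (S.star j) j = 0)).resolve_left hc
    have hV0 : ∑ l ∈ (S.core i j)ᶜ, S.p i j l * S.valency l = 0 := by
      rw [heq] at e8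
      have := Nat.eq_of_mul_eq_mul_left hfpos e8
      omega
    have hV := fun l (hl : l ∉ S.core i j) => p_eq_zero_of_sum_eq_zero hV0 hl
    have hv := h.p_right_ne_zero hc heq ha hu hV
    have hk0 := S.valency_pos i
    have e9 : S.p i j j * S.valency i + ∑ l ∈ (S.core i j)ᶜ, S.p i (S.star j) l * S.valency l =
        S.valency i := by
      have ek : S.valency i * S.valency i =
          (1 + 2 * S.p i i i + 2 * S.p i (S.star i) j) * S.valency i := by rw [← e5]
      rw [ha] at ek
      rw [hu, heq] at e7
      linarith
    have hv1 : S.p i j j = 1 := by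
      have : S.p i j j * S.valency i ≤ 1 * S.valency i := by omega
      have := Nat.le_of_mul_le_mul_right this hk0
      omega
    rw [hv1] at e9
    exact ⟨h.core_eq_univ hV fun l hl => p_eq_zero_of_sum_eq_zero (by omega) hl,
      Or.inr (Or.inl ⟨heq, ha, hv1⟩)⟩
  · obtain ⟨hu, hU⟩ := eq_zero_of_lt e1 e2 e4 e5 e7 hgt
    rw [hU, mul_zero, add_zero] at e8
    have hV := (Nat.mul_eq_zero.1 e8.symm).resolve_left hf
    exact ⟨h.core_eq_univ (fun l hl => p_eq_zero_of_sum_eq_zero hV hl)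
      fun l hl => p_eq_zero_of_sum_eq_zero hU hl, Or.inr (Or.inr ⟨hgt, hu⟩)⟩

end SparseGenerator
end AssociationScheme

namespace AssociationScheme
variable {X : Type*} [Fintype X] {d : ℕ} (S : AssociationScheme X d)

/-! ### Primitive idempotents of the Bose-Mesner algebra -/

open Classical

theorem adjMatrix_mem (i : Fin (d + 1)) : S.adjMatrix i ∈ S.boseMesner :=
  Algebra.subset_adjoin ⟨i, rfl⟩

theorem mem_boseMesner_iff {M : Matrix X X ℂ} :
    M ∈ S.boseMesner ↔ ∃ q : Fin (d + 1) → ℂ, M = ∑ i, q i • S.adjMatrix i := by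
  constructor
  · intro h
    refine Algebra.adjoin_induction (p := fun M _ => ∃ q : Fin (d + 1) → ℂ,
      M = ∑ i, q i • S.adjMatrix i) ?_ ?_ ?_ ?_ h
    · rintro _ ⟨i, rfl⟩
      exact ⟨Pi.single i 1, by simp [Pi.single_apply]⟩
    · intro r
      refine ⟨Pi.single 0 r, ?_⟩
      simp only [Pi.single_apply, ite_smul, zero_smul, Finset.sum_ite_eq', Finset.mem_univ,
        if_true, adjMatrix_zero]
      rw [Algebra.algebraMap_eq_smul_one]
    · rintro _ _ - - ⟨q, rfl⟩ ⟨r, rfl⟩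
      exact ⟨q + r, by simp [add_smul, Finset.sum_add_distrib]⟩
    · rintro _ _ - - ⟨q, rfl⟩ ⟨r, rfl⟩
      refine ⟨fun l => ∑ i, ∑ j, q i * r j * S.p i j l, ?_⟩
      simp only [Finset.sum_mul, Finset.mul_sum, Matrix.smul_mul, Matrix.mul_smul, adjMatrix_mul,
        Finset.smul_sum, Finset.sum_smul, smul_smul]
      rw [Finset.sum_comm]
      conv_rhs => rw [Finset.sum_comm]
      refine Finset.sum_congr rfl fun i _ => ?_
      conv_rhs => rw [Finset.sum_comm]
      refine Finset.sum_congr rfl fun j _ => Finset.sum_congr rfl fun l _ => ?_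
      congr 1
      ring
  · rintro ⟨q, rfl⟩
    exact Subalgebra.sum_mem _ fun i _ => Subalgebra.smul_mem _ (S.adjMatrix_mem i) _

theorem conjTranspose_mem {M : Matrix X X ℂ} (h : M ∈ S.boseMesner) :
    M.conjTranspose ∈ S.boseMesner := by
  obtain ⟨q, rfl⟩ := S.mem_boseMesner_iff.1 h
  rw [Matrix.conjTranspose_sum]
  refine Subalgebra.sum_mem _ fun i _ => ?_
  have : (S.adjMatrix i).conjTranspose = S.adjMatrix (S.star i) := by
    ext x y
    simp only [Matrix.conjTranspose_apply, adjMatrix_apply, S.rel_star]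
    split_ifs <;> simp
  rw [Matrix.conjTranspose_smul, this]
  exact Subalgebra.smul_mem _ (S.adjMatrix_mem _) _

theorem mul_comm_of_mem (hc : S.IsCommutative) {M N : Matrix X X ℂ} (hM : M ∈ S.boseMesner)
    (hN : N ∈ S.boseMesner) : M * N = N * M := by
  obtain ⟨q, rfl⟩ := S.mem_boseMesner_iff.1 hM
  obtain ⟨r, rfl⟩ := S.mem_boseMesner_iff.1 hN
  rw [Finset.sum_mul_sum, Finset.sum_mul_sum, Finset.sum_comm]
  refine Finset.sum_congr rfl fun i _ => Finset.sum_congr rfl fun j _ => ?_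
  rw [Matrix.smul_mul, Matrix.mul_smul, Matrix.smul_mul, Matrix.mul_smul, smul_comm,
    adjMatrix_mul, adjMatrix_mul]
  simp only [hc j i]

open ComplexOrder in
theorem eq_zero_of_mul_self_eq_zero (hc : S.IsCommutative) {M : Matrix X X ℂ}
    (hM : M ∈ S.boseMesner) (h : M * M = 0) : M = 0 := by
  have hM' := S.conjTranspose_mem hM
  rw [← Matrix.conjTranspose_mul_self_eq_zero, ← Matrix.conjTranspose_mul_self_eq_zero,
    Matrix.conjTranspose_mul, Matrix.conjTranspose_conjTranspose]
  calc M.conjTranspose * M * (M.conjTranspose * M)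
      = M.conjTranspose * (M * M.conjTranspose) * M := by simp only [mul_assoc]
    _ = M.conjTranspose * (M.conjTranspose * M) * M := by rw [S.mul_comm_of_mem hc hM hM']
    _ = M.conjTranspose * M.conjTranspose * (M * M) := by simp only [mul_assoc]
    _ = 0 := by rw [h, mul_zero]

/-- A finite-dimensional reduced commutative complex algebra is a product of copies of `ℂ`; the
`e i` are the unit vectors of the factors. -/
theorem _root_.exists_idempotents_of_isReduced.{u} (R : Type u) [CommRing R] [Algebra ℂ R]
    [Module.Finite ℂ R] [IsReduced R] :
    ∃ (ι : Type u) (_ : Fintype ι) (e : ι → R), ∑ i, e i = 1 ∧ (∀ i, e i ≠ 0) ∧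
      (∀ i, e i * e i = e i) ∧ ∀ i x, ∃ c : ℂ, x * e i = c • e i := by
  have : IsArtinianRing R := IsArtinianRing.of_finite ℂ R
  have := Fintype.ofFinite (MaximalSpectrum R)
  let φ := IsArtinianRing.equivPi R
  refine ⟨MaximalSpectrum R, inferInstance, fun I => φ.symm (Pi.single I 1), ?_, ?_, ?_, ?_⟩
  · rw [← map_sum, Finset.univ_sum_single (fun I : MaximalSpectrum R => (1 : R ⧸ I.asIdeal))]
    exact map_one _
  · intro I h
    have h' := congrArg φ h
    rw [AlgEquiv.apply_symm_apply, map_zero] at h'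
    have := congrFun h' I
    rw [Pi.single_eq_same] at this
    exact one_ne_zero this
  · intro I
    rw [← map_mul, ← Pi.single_mul, one_mul]
  · intro I x
    obtain ⟨c, hc⟩ := (IsAlgClosed.algebraMap_bijective_of_isIntegral
      (k := ℂ) (K := R ⧸ I.asIdeal)).2 (Ideal.Quotient.mk _ x)
    refine ⟨c, φ.injective ?_⟩
    rw [Algebra.smul_def, map_mul, map_mul, AlgEquiv.apply_symm_apply]
    funext J
    by_cases hJ : J = I
    · subst hJ
      simp only [Pi.mul_apply, Pi.single_eq_same, mul_one]
      exact hc.symm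
    · simp [Pi.single_eq_of_ne hJ]

/-- The identity is the sum of primitive idempotents, on each of which the Bose-Mesner algebra
acts by scalars. -/
theorem exists_primitive_idempotents.{u} {X : Type u} [Fintype X] {d : ℕ}
    (S : AssociationScheme X d) (hc : S.IsCommutative) :
    ∃ (ι : Type u) (_ : Fintype ι) (E : ι → Matrix X X ℂ),
      (∀ M : Matrix X X ℂ, M = ∑ i, M * E i) ∧ ∀ i, S.IsPrimitiveIdempotent (E i) ∧
        ∀ M ∈ S.boseMesner, ∃ c : ℂ, M * E i = c • E i := by
  let _ : CommRing S.boseMesner :=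
    { (inferInstance : Ring S.boseMesner) with
      mul_comm := fun a b => Subtype.ext (S.mul_comm_of_mem hc a.2 b.2) }
  have : IsReduced S.boseMesner := by
    rw [isReduced_iff_pow_one_lt 2 one_lt_two]
    intro M hM
    refine Subtype.ext (S.eq_zero_of_mul_self_eq_zero hc M.2 ?_)
    rw [sq] at hM
    exact congrArg Subtype.val hM
  obtain ⟨ι, hι, e, h1, h0, hsq, hsc⟩ := exists_idempotents_of_isReduced S.boseMesner
  have hsc' : ∀ i, ∀ M ∈ S.boseMesner, ∃ c : ℂ, M * (e i : Matrix X X ℂ) = c • (e i).1 := by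
    intro i M hM
    obtain ⟨c, h⟩ := hsc i ⟨M, hM⟩
    exact ⟨c, congrArg Subtype.val h⟩
  have hne : ∀ i, (e i : Matrix X X ℂ) ≠ 0 := fun i h => h0 i (Subtype.ext h)
  refine ⟨ι, hι, fun i => e i, fun M => ?_, fun i => ⟨⟨(e i).2, hne i,
    congrArg Subtype.val (hsq i), fun F hF hFF _ hFE => ?_⟩, hsc' i⟩⟩
  · have : ∑ i, (e i : Matrix X X ℂ) = 1 := by
      have := congrArg Subtype.val h1
      rw [AddSubmonoidClass.coe_finsetSum] at this
      exact this
    rw [← Finset.mul_sum, this, mul_one]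
  · obtain ⟨c, h⟩ := hsc' i F hF
    rw [hFE] at h
    have hEE : (e i : Matrix X X ℂ) * e i = e i := congrArg Subtype.val (hsq i)
    rw [h, Matrix.smul_mul, Matrix.mul_smul, hEE, smul_smul] at hFF
    have := smul_left_injective ℂ (hne i) hFF
    rcases eq_or_ne c 0 with rfl | h0
    · exact Or.inl (by rw [h, zero_smul])
    · right
      rw [h, (mul_eq_right₀ h0).1 this, one_smul]

theorem _root_.Matrix.trace_eq_rank_of_mul_self_eq {E : Matrix X X ℂ} (h : E * E = E) :
    E.trace = E.rank := by
  have hE : IsIdempotentElem E.toLin' := by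
    rw [IsIdempotentElem, Module.End.mul_eq_comp, ← Matrix.toLin'_mul, h]
  rw [← Matrix.trace_toLin'_eq, (LinearMap.IsIdempotentElem.isProj_range _ hE).trace, Matrix.rank, Matrix.toLin'_apply']

/-- The matrix `∑ k_i⁻¹ A_i A_iᵀ`; a primitive idempotent `E` is an eigenmatrix for the eigenvalue
`|X| / rank E`. -/
noncomputable def normalizedSum : Matrix X X ℂ :=
  ∑ i, (S.valency i : ℂ)⁻¹ • (S.adjMatrix i * S.adjMatrix (S.star i))

theorem normalizedSum_apply {l : Fin (d + 1)} {x y : X} (h : S.rel l x y) :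
    S.normalizedSum x y = ∑ i, (S.valency i : ℂ)⁻¹ * S.p i (S.star i) l := by
  simp only [normalizedSum, Matrix.sum_apply, Matrix.smul_apply, S.adjMatrix_mul_apply h,
    smul_eq_mul]

theorem card_ne_zero (S : AssociationScheme X d) : (Fintype.card X : ℂ) ≠ 0 := by
  have := S.nonempty_points
  exact_mod_cast Fintype.card_ne_zero

theorem normalizedSum_mul (hc : S.IsCommutative) {E : Matrix X X ℂ} (hE : E ∈ S.boseMesner)
    (h0 : E ≠ 0) (hEE : E * E = E) (hsc : ∀ M ∈ S.boseMesner, ∃ c : ℂ, M * E = c • E) :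
    S.normalizedSum * E = (Fintype.card X / E.rank : ℂ) • E := by
  have hn := S.card_ne_zero
  have hk : ∀ i, (S.valency i : ℂ) ≠ 0 := fun i => by exact_mod_cast (S.valency_pos i).ne'
  choose p hp using fun i => hsc _ (S.adjMatrix_mem i)
  obtain ⟨q, hq⟩ := S.mem_boseMesner_iff.1 hE
  have hrank : (E.rank : ℂ) ≠ 0 := by
    intro h
    have h' : E.toLin' = 0 := by
      have : Module.finrank ℂ (LinearMap.range E.toLin') = 0 := by exact_mod_cast h
      rwa [Submodule.finrank_eq_zero, LinearMap.range_eq_bot] at this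
    exact h0 (by simpa using h')
  have htr := Matrix.trace_eq_rank_of_mul_self_eq hEE
  -- Comparing traces of `A_iᵀ E` expresses the coefficients of `E` through its eigenvalues.
  have hcoef : ∀ i, Fintype.card X * S.valency i * q i = p (S.star i) * E.rank := by
    intro i
    have h1 : (S.adjMatrix (S.star i) * E).trace = p (S.star i) * E.rank := by
      rw [hp, Matrix.trace_smul, htr, smul_eq_mul]
    rw [← h1, S.mul_comm_of_mem hc (S.adjMatrix_mem _) hE]
    conv_rhs => rw [hq]
    simp only [Finset.sum_mul, Matrix.smul_mul, Matrix.trace_sum, Matrix.trace_smul,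
      trace_adjMatrix_mul_star, smul_eq_mul, mul_ite, mul_zero, Finset.sum_ite_eq',
      Finset.mem_univ, if_true]
    ring
  have hsum : ∑ i, q i * p i = 1 := by
    have h1 : E * E = (∑ i, q i * p i) • E := by
      conv_lhs => rw [show E * E = (∑ i, q i • S.adjMatrix i) * E by rw [← hq]]
      simp only [Finset.sum_mul, Matrix.smul_mul, hp, smul_smul, Finset.sum_smul]
    rw [hEE] at h1
    have h2 : (1 : ℂ) • E = (∑ i, q i * p i) • E := by rw [one_smul, ← h1]
    exact (smul_left_injective ℂ h0 h2).symm
  have hME : S.normalizedSum * E = (∑ i, (S.valency i : ℂ)⁻¹ * (p (S.star i) * p i)) • E := by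
    simp only [normalizedSum, Finset.sum_mul, Matrix.smul_mul, mul_assoc, hp, Matrix.mul_smul,
      smul_smul, Finset.sum_smul]
  rw [hME]
  congr 1
  rw [eq_div_iff hrank, Finset.sum_mul]
  calc ∑ i, (S.valency i : ℂ)⁻¹ * (p (S.star i) * p i) * E.rank
      = ∑ i, Fintype.card X * (q i * p i) := by
        refine Finset.sum_congr rfl fun i _ => ?_
        have e := hcoef i
        field_simp [hk i]
        linear_combination (-p i) * e
    _ = Fintype.card X := by rw [← Finset.mul_sum, hsum, mul_one]

theorem adjMatrix_mul_trivialIdempotent (i : Fin (d + 1)) :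
    S.adjMatrix i * trivialIdempotent X = (S.valency i : ℂ) • trivialIdempotent X := by
  rw [trivialIdempotent, Matrix.mul_smul, adjMatrix_mul_ones, smul_comm]

theorem trivialIdempotent_mem : trivialIdempotent X ∈ S.boseMesner := by
  rw [trivialIdempotent, ← S.sum_adjMatrix]
  exact Subalgebra.smul_mem _ (Subalgebra.sum_mem _ fun i _ => S.adjMatrix_mem i) _

theorem mul_trivialIdempotent {M : Matrix X X ℂ} (hM : M ∈ S.boseMesner) :
    ∃ c : ℂ, M * trivialIdempotent X = c • trivialIdempotent X := by
  obtain ⟨q, rfl⟩ := S.mem_boseMesner_iff.1 hM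
  refine ⟨∑ i, q i * S.valency i, ?_⟩
  simp only [Finset.sum_mul, Matrix.smul_mul, adjMatrix_mul_trivialIdempotent, smul_smul,
    Finset.sum_smul]

theorem trivialIdempotent_mul_self (S : AssociationScheme X d) :
    trivialIdempotent X * trivialIdempotent X = trivialIdempotent X := by
  have hn := S.card_ne_zero
  ext x y
  simp [trivialIdempotent, Matrix.mul_apply, hn]

theorem trivialIdempotent_ne_zero (S : AssociationScheme X d) : trivialIdempotent X ≠ 0 := by
  obtain ⟨x⟩ := S.nonempty_points
  intro h
  have := congrFun (congrFun h x) x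
  simp [trivialIdempotent, S.card_ne_zero] at this

theorem normalizedSum_mul_trivialIdempotent (hc : S.IsCommutative) :
    S.normalizedSum * trivialIdempotent X = (Fintype.card X : ℂ) • trivialIdempotent X := by
  simp only [normalizedSum, Finset.sum_mul, Matrix.smul_mul, mul_assoc,
    adjMatrix_mul_trivialIdempotent, Matrix.mul_smul, smul_smul, ← Finset.sum_smul,
    S.valency_star hc]
  congr 1
  rw [← S.sum_valency]
  push_cast
  refine Finset.sum_congr rfl fun i _ => ?_
  have : (S.valency i : ℂ) ≠ 0 := by exact_mod_cast (S.valency_pos i).ne'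
  field_simp

/-- In a pseudocyclic scheme, `∑ k_i⁻¹ A_i A_iᵀ` is a combination of the identity and the all-one
matrix. -/
theorem IsPseudocyclic.exists_normalizedSum_eq (h : S.IsPseudocyclic) :
    ∃ m : ℕ, S.normalizedSum = (Fintype.card X / m : ℂ) • (1 : Matrix X X ℂ) +
      (Fintype.card X - Fintype.card X / m : ℂ) • trivialIdempotent X := by
  obtain ⟨hc, m, hm⟩ := h
  refine ⟨m, ?_⟩
  obtain ⟨ι, hι, E, hE1, hE⟩ := S.exists_primitive_idempotents hc
  rw [hE1 S.normalizedSum, hE1 ((_ : Matrix X X ℂ) + _)]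
  refine Finset.sum_congr rfl fun i _ => ?_
  obtain ⟨⟨hmem, hne, hsq, hprim⟩, hsc⟩ := hE i
  rw [add_mul, Matrix.smul_mul, one_mul, Matrix.smul_mul]
  have hT := S.trivialIdempotent_mul_self
  by_cases hT0 : E i = trivialIdempotent X
  · rw [hT0, S.normalizedSum_mul_trivialIdempotent hc, hT, ← add_smul]
    congr 1
    ring
  · -- The product of two different primitive idempotents is a multiple of both, hence zero.
    have hzero : trivialIdempotent X * E i = 0 := by
      obtain ⟨c, h1⟩ := hsc _ S.trivialIdempotent_mem
      have hcm := S.mul_comm_of_mem hc S.trivialIdempotent_mem hmem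
      obtain ⟨c', h2⟩ := S.mul_trivialIdempotent hmem
      by_contra hne0
      have hTE : trivialIdempotent X * E i * (trivialIdempotent X * E i) =
          trivialIdempotent X * E i := by
        conv_lhs => rw [mul_assoc, ← mul_assoc (E i), ← hcm, mul_assoc, hsq, ← mul_assoc, hT]
      have hTEmem := Subalgebra.mul_mem _ S.trivialIdempotent_mem hmem
      have e1 : trivialIdempotent X * E i = E i := by
        refine (hprim _ hTEmem hTE ?_ ?_).resolve_left hne0
        · rw [hcm, ← mul_assoc, hsq]
        · rw [mul_assoc, hsq]
      rw [hcm, h2] at e1 hne0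
      have hc0 : c' ≠ 0 := fun h => hne0 (by rw [h, zero_smul])
      rw [← e1, Matrix.smul_mul, Matrix.mul_smul, hT, smul_smul] at hsq
      have := smul_left_injective ℂ S.trivialIdempotent_ne_zero hsq
      rw [(mul_eq_right₀ hc0).1 this, one_smul] at e1
      exact hT0 e1.symm
    rw [S.normalizedSum_mul hc hmem hne hsq hsc, hm _ (hE i).1 hT0, hzero, smul_zero, add_zero]

/-- In a pseudocyclic scheme with at least one class, `m = (|X| - 1) / d`, and the normalized
numbers of common out-neighbours of two distinct points add up to `1 - 1 / m`. -/
theorem IsPseudocyclic.exists_sum_eq (h : S.IsPseudocyclic) (hd : d ≠ 0) :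
    ∃ m : ℕ, m ≠ 0 ∧ m * d + 1 = Fintype.card X ∧ ∀ l ≠ 0,
      ∑ i, (S.valency i : ℂ)⁻¹ * S.p i (S.star i) l = 1 - (m : ℂ)⁻¹ := by
  obtain ⟨m, hm⟩ := IsPseudocyclic.exists_normalizedSum_eq S h
  have hn := S.card_ne_zero
  have hdiag : (d + 1 : ℂ) = Fintype.card X / m + (1 - (m : ℂ)⁻¹) := by
    obtain ⟨x⟩ := S.nonempty_points
    have h1 := S.normalizedSum_apply ((S.rel_zero x x).2 rfl)
    have h2 : ∀ i, (S.valency i : ℂ)⁻¹ * S.p i (S.star i) 0 = 1 := fun i =>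
      inv_mul_cancel₀ (by exact_mod_cast (S.valency_pos i).ne')
    simp only [h2, hm, Finset.sum_const, Finset.card_univ, Fintype.card_fin, nsmul_eq_mul] at h1
    simp only [trivialIdempotent, Matrix.add_apply, Matrix.smul_apply, Matrix.one_apply_eq,
      Matrix.of_apply, smul_eq_mul] at h1
    push_cast at h1
    simp only [mul_one] at h1
    rw [← h1]
    field_simp
  have hm0 : m ≠ 0 := by
    rintro rfl
    simp [hd] at hdiag
  have hm0' : (m : ℂ) ≠ 0 := by exact_mod_cast hm0
  refine ⟨m, hm0, ?_, fun l hl => ?_⟩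
  · field_simp at hdiag
    have : (m * d + 1 : ℂ) = Fintype.card X := by linear_combination hdiag
    exact_mod_cast this
  · obtain ⟨x, y, hxy⟩ := S.rel_nonempty l
    have hne : x ≠ y := fun e => hl (S.rel_unique hxy ((S.rel_zero x y).2 e))
    rw [← S.normalizedSum_apply hxy, hm]
    simp only [trivialIdempotent, Matrix.add_apply, Matrix.smul_apply, Matrix.one_apply_ne hne,
      Matrix.of_apply, smul_eq_mul]
    field_simp
    ring

end AssociationScheme

namespace AssociationScheme
variable {X : Type*} [Fintype X] {d : ℕ} {S : AssociationScheme X d}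
namespace SparseGenerator

variable {i j : Fin (d + 1)}

/-! ### Pseudocyclic schemes -/

theorem card_eq (h : S.SparseGenerator i j) (hF : S.core i j = Finset.univ) :
    Fintype.card X = 4 * S.valency i + 1 := by
  rw [← S.sum_valency, h.sum_eq, hF, S.valency_zero, h.valency_star_left, h.valency_star_right,
    h.valency_eq]
  simp
  ring

/-- In a pseudocyclic scheme, two distinct points have `(k - 1) / 2` common out-neighbours with
respect to the two relations `R_i` and `R_j` together. -/
theorem two_mul_add_one_eq (h : S.SparseGenerator i j) (hF : S.core i j = Finset.univ)
    (hps : S.IsPseudocyclic) {l : Fin (d + 1)} (hl : l ≠ 0) :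
    2 * (S.p i (S.star i) l + S.p j (S.star j) l) + 1 = S.valency i := by
  have hd := h.d_eq_four_of_core_eq_univ hF
  obtain ⟨m, -, hm, hsum⟩ := IsPseudocyclic.exists_sum_eq S hps (by omega)
  rw [h.card_eq hF] at hm
  have hmk : m = S.valency i := by
    have : m * d = m * 4 := congrArg (m * ·) hd
    omega
  have hk0 : (S.valency i : ℂ) ≠ 0 := by exact_mod_cast (S.valency_pos i).ne'
  have hterm : ∀ r, (S.valency r : ℂ)⁻¹ * S.p r (S.star r) l =
      (S.valency i : ℂ)⁻¹ * S.p r (S.star r) l := by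
    intro r
    have hr : r ∈ S.core i j := hF ▸ Finset.mem_univ r
    rcases mem_core.1 hr with rfl | rfl | rfl | rfl | rfl
    · rw [S.star_zero, S.p_zero_right, if_neg hl.symm, Nat.cast_zero, mul_zero, mul_zero]
    · rfl
    · rw [h.valency_star_left]
    · rw [h.valency_eq]
    · rw [h.valency_star_right]
  have e := hsum l hl
  simp only [hterm, ← Finset.mul_sum] at e
  rw [hmk, ← Nat.cast_sum, h.sum_eq, hF, S.star_zero, S.p_zero_right, if_neg hl.symm,
    S.star_star, S.star_star, h.comm (S.star i), h.comm (S.star j), Finset.compl_univ,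
    Finset.sum_empty] at e
  field_simp at e
  rw [eq_sub_iff_add_eq] at e
  have e' : 0 + S.p i (S.star i) l + S.p i (S.star i) l + S.p j (S.star j) l +
    S.p j (S.star j) l + 0 + 1 = S.valency i := by exact_mod_cast e
  omega

/-- With `t = f - a`, the equations reduce to `a (a² + t² - t) = 0`. -/
theorem false_of_lt {a b c f : ℕ} (e1 : b ^ 2 + c ^ 2 = 1 + 2 * a + 2 * f + a ^ 2 + 2 * f ^ 2)
    (e2 : c * f = a * c + f * f) (e4 : a + b + c = 1 + 2 * a + 2 * f) (hf : f ≠ 0)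
    (hfc : f < c) : False := by
  have hfpos := Nat.pos_of_ne_zero hf
  have haf : a < f := by
    by_contra hle
    have := Nat.mul_le_mul_left c (not_lt.1 hle)
    nlinarith
  obtain ⟨t, rfl⟩ := Nat.exists_eq_add_of_lt haf
  zify at e1 e2 e4 hfc
  have hb : (b : ℤ) = 1 + a + 2 * (a + t + 1) - c := by linarith
  have hct : (c : ℤ) * (t + 1) = (a + t + 1) ^ 2 := by linear_combination e2
  have hbc : (b : ℤ) * c = (a + t + 1) * (2 * a + 1 + (a + t + 1)) := by
    have : 2 * ((b : ℤ) * c) = 2 * ((a + t + 1) * (2 * a + 1 + (a + t + 1))) := by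
      have e5 : (b + c : ℤ) ^ 2 = (1 + a + 2 * (a + t + 1)) ^ 2 := by rw [hb]; ring
      linear_combination e5 - e1
    linarith
  have key : (a + t + 1 : ℤ) * (a * (a ^ 2 + (t + 1) ^ 2 - (t + 1))) = 0 := by
    have h1 : (b : ℤ) * c * (t + 1) ^ 2 =
        ((1 + a + 2 * (a + t + 1)) * (t + 1) - (a + t + 1) ^ 2) * (a + t + 1) ^ 2 := by
      rw [← hct, hb]
      ring
    rw [hbc] at h1
    linear_combination h1
  rcases mul_eq_zero.1 key with h | h
  · omega
  · rcases mul_eq_zero.1 h with h | h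
    · rw [h] at hct
      have : (c : ℤ) * (t + 1) = (t + 1) * (t + 1) := by linear_combination hct
      have := mul_right_cancel₀ (by omega : (t + 1 : ℤ) ≠ 0) this
      omega
    · have ha : (a : ℤ) ^ 2 + t * (t + 1) = 0 := by linear_combination h
      have ha0 : (a : ℤ) = 0 := by
        have : (0 : ℤ) ≤ t * (t + 1) := by positivity
        nlinarith
      rw [ha0] at hct
      have : (c : ℤ) * (t + 1) = (t + 1) * (t + 1) := by linear_combination hct
      have := mul_right_cancel₀ (by omega : (t + 1 : ℤ) ≠ 0) this
      omega

/-- The intersection numbers of `Cyc(13, 4)`. -/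
theorem intersection_numbers (h : S.SparseGenerator i j) (hk : S.valency i ≠ 1)
    (hps : S.IsPseudocyclic) : S.core i j = Finset.univ ∧ S.valency i = 3 ∧ S.p i i i = 0 ∧
      S.p i i (S.star i) = 2 ∧ S.p i i j = 1 ∧ S.p i (S.star i) j = 1 := by
  obtain ⟨hF, hcases⟩ := h.core_eq_univ_and hk
  have hf := h.p_mul_star_ne_zero hk
  have e1 := h.sq_add_sq
  have e2 := h.mul_p_right
  have e4 := h.valency_eq_sq
  have e5 := h.valency_eq_mul_star
  have hv : S.p i j j = S.p i (S.star i) j := by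
    have e := h.two_mul_add_one_eq hF hps h.zero_ne.1.symm
    have e' := S.p_mul_valency_left j (S.star j) i
    rw [h.valency_eq, S.star_star] at e'
    rw [Nat.eq_of_mul_eq_mul_right (S.valency_pos i) e', S.p_mul_star_self] at e
    omega
  refine ⟨hF, ?_⟩
  rcases hcases with hc | ⟨hc, ha, hv1⟩ | ⟨hlt, hu⟩
  · rw [hc, hv, zero_mul, mul_zero, zero_add] at e2
    have := (Nat.mul_eq_zero.1 e2.symm).resolve_left hf
    omega
  · omega
  · rw [hu, hv, add_zero] at e2
    rw [e5] at e1 e4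
    exact (false_of_lt e1 e2 e4.symm hf hlt).elim

end SparseGenerator
end AssociationScheme

/-! ### Reconstruction of the Cayley digraph of `{1, 3, 9}` on `ZMod 13` -/

/-- The local properties of the Cayley digraph of `{1, 3, 9}` on `ZMod 13` from which it is
reconstructed: out- and in-degree at most 3, no transitive triangles, one common out-neighbour of
any two non-adjacent points, and two paths of length two from the head to the tail of an arc, but
at most one between other points. -/
structure IsThirteenDigraph {X : Type*} (R : X → X → Prop) : Prop where
  asymm : ∀ {x y}, R x y → ¬ R y x
  no_trans : ∀ {x y z}, R x y → R y z → ¬ R x z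
  out : ∀ {x a b c e}, R x a → R x b → R x c → a ≠ b → a ≠ c → b ≠ c → R x e →
    e = a ∨ e = b ∨ e = c
  inn : ∀ {x a b c e}, R a x → R b x → R c x → a ≠ b → a ≠ c → b ≠ c → R e x →
    e = a ∨ e = b ∨ e = c
  out_unique : ∀ {x y z w}, x ≠ y → R x z → R y z → R x w → R y w → z = w
  exists_out : ∀ {x y}, x ≠ y → ¬ R x y → ¬ R y x → ∃ z, R x z ∧ R y z
  exists_path : ∀ {x y}, R y x → ∀ u, ∃ z, z ≠ u ∧ R x z ∧ R z y
  path_unique : ∀ {x y z w}, ¬ R y x → R x z → R z y → R x w → R w y → z = w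
  path_le_two : ∀ {x y a b c}, R x a → R a y → R x b → R b y → R x c → R c y →
    a = b ∨ a = c ∨ b = c

namespace IsThirteenDigraph
variable {X : Type*} {R : X → X → Prop}

/-- The arcs of a partial embedding `g`, defined at `0`, at its out-neighbours and at the points
reached from them; the values of `g` at `7`, `8` and `11` do not matter. -/
structure Start (R : X → X → Prop) (g : ZMod 13 → X) : Prop where
  h01 : R (g 0) (g 1)
  h03 : R (g 0) (g 3)
  h09 : R (g 0) (g 9)
  n13 : g 1 ≠ g 3
  n19 : g 1 ≠ g 9
  n39 : g 3 ≠ g 9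
  h14 : R (g 1) (g 4)
  h34 : R (g 3) (g 4)
  h3c : R (g 3) (g 12)
  h9c : R (g 9) (g 12)
  h9a : R (g 9) (g 10)
  h1a : R (g 1) (g 10)
  h12 : R (g 1) (g 2)
  h23 : R (g 2) (g 3)
  h36 : R (g 3) (g 6)
  h69 : R (g 6) (g 9)
  h95 : R (g 9) (g 5)
  h51 : R (g 5) (g 1)

theorem Start.rotate {g : ZMod 13 → X} (h : Start R g) : Start R fun u => g (3 * u) where
  h01 := h.h03
  h03 := h.h09
  h09 := h.h01
  n13 := h.n39
  n19 := h.n13.symm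
  n39 := h.n19.symm
  h14 := h.h3c
  h34 := h.h9c
  h3c := h.h9a
  h9c := h.h1a
  h9a := h.h14
  h1a := h.h34
  h12 := h.h36
  h23 := h.h69
  h36 := h.h95
  h69 := h.h51
  h95 := h.h12
  h51 := h.h23

variable {g : ZMod 13 → X}

theorem arc_four_zero (hR : IsThirteenDigraph R) (h : Start R g) : R (g 4) (g 0) := by
  by_contra hn
  exact h.n13 (hR.path_unique hn h.h01 h.h14 h.h03 h.h34)

theorem four_ne_twelve (hR : IsThirteenDigraph R) (h : Start R g) : g 4 ≠ g 12 := by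
  intro e
  have h1 := h.n13
  have h2 := h.n19
  have h3 := h.n39
  have := hR.path_le_two h.h01 h.h14 h.h03 h.h34 h.h09 (e ▸ h.h9c)
  tauto

theorem arc_four_five (hR : IsThirteenDigraph R) (h : Start R g) : R (g 4) (g 5) := by
  have h40 := hR.arc_four_zero h
  have hc0 : R (g 12) (g 0) := hR.arc_four_zero h.rotate
  have hca : g 12 ≠ g 10 := hR.four_ne_twelve h.rotate
  have ha4 : g 10 ≠ g 4 := hR.four_ne_twelve h.rotate.rotate
  have h5a : g 5 ≠ g 10 := fun e => hR.asymm h.h51 (e ▸ h.h1a)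
  have h5c : g 5 ≠ g 12 := fun e => hR.no_trans hc0 h.h01 (e ▸ h.h51)
  have hout : ∀ {e}, R (g 9) e → e = g 10 ∨ e = g 12 ∨ e = g 5 :=
    hR.out h.h9a h.h9c h.h95 hca.symm h5a.symm h5c.symm
  have hn49 : g 4 ≠ g 9 := fun e => hR.asymm h40 (e ▸ h.h09)
  have h94 : ¬ R (g 9) (g 4) := by
    intro h94
    rcases hout h94 with e | e | e
    · exact ha4 e.symm
    · exact hR.four_ne_twelve h e
    · exact hR.asymm h.h14 (e ▸ h.h51)
  obtain ⟨z, h4z, h9z⟩ := hR.exists_out hn49 (hR.no_trans h40 h.h09) h94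
  rcases hout h9z with rfl | rfl | rfl
  · exact absurd h.h1a (hR.no_trans h.h14 h4z)
  · exact absurd h.h3c (hR.no_trans h.h34 h4z)
  · exact h4z

theorem arc_two_five (hR : IsThirteenDigraph R) (h : Start R g) : R (g 2) (g 5) := by
  have h45 := hR.arc_four_five h
  have h40 := hR.arc_four_zero h
  have ha0 : R (g 10) (g 0) := hR.arc_four_zero h.rotate.rotate
  have ha4 : g 10 ≠ g 4 := hR.four_ne_twelve h.rotate.rotate
  have h24 : g 2 ≠ g 4 := fun e => hR.asymm h.h34 (e ▸ h.h23)
  have h2a : g 2 ≠ g 10 := fun e => hR.no_trans ha0 h.h03 (e ▸ h.h23)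
  obtain ⟨z, hz4, h1z, hz5⟩ := hR.exists_path h.h51 (g 4)
  rcases hR.out h.h12 h.h14 h.h1a h24 h2a ha4.symm h1z with rfl | rfl | rfl
  · exact hz5
  · exact absurd rfl hz4
  · have e := hR.out_unique ha4 ha0 h40 hz5 h45
    exact absurd (e ▸ h.h95) (hR.asymm h.h09)

/-- The point found here becomes the image of `11` and, after rotation, of `7` and `8`. -/
theorem exists_eleven (hR : IsThirteenDigraph R) (h : Start R g) :
    ∃ w, R (g 2) w ∧ R w (g 1) ∧ w ≠ g 5 := by
  obtain ⟨z, h5, h2, h1⟩ := hR.exists_path h.h12 (g 5)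
  exact ⟨z, h2, h1, h5⟩

/-- The arcs of a labelling of thirteen points that extends a partial embedding. -/
structure Labelling (R : X → X → Prop) (g : ZMod 13 → X) : Prop extends Start R g where
  h2b : R (g 2) (g 11)
  hb1 : R (g 11) (g 1)
  nb5 : g 11 ≠ g 5
  h67 : R (g 6) (g 7)
  h73 : R (g 7) (g 3)
  n72 : g 7 ≠ g 2
  h58 : R (g 5) (g 8)
  h89 : R (g 8) (g 9)
  n86 : g 8 ≠ g 6

theorem Labelling.rotate {g : ZMod 13 → X} (h : Labelling R g) :
    Labelling R fun u => g (3 * u) where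
  toStart := h.toStart.rotate
  h2b := h.h67
  hb1 := h.h73
  nb5 := h.n72
  h67 := h.h58
  h73 := h.h89
  n72 := h.n86
  h58 := h.h2b
  h89 := h.hb1
  n86 := h.nb5

theorem exists_labelling (hR : IsThirteenDigraph R) (h : Start R g) :
    ∃ g' : ZMod 13 → X, Labelling R g' := by
  obtain ⟨w, w1, w2, w3⟩ := hR.exists_eleven h
  obtain ⟨v, v1, v2, v3⟩ := hR.exists_eleven h.rotate
  obtain ⟨u, u1, u2, u3⟩ := hR.exists_eleven h.rotate.rotate
  exact ⟨(![g 0, g 1, g 2, g 3, g 4, g 5, g 6, v, u, g 9, g 10, w, g 12] : Fin 13 → X),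
    { h01 := h.h01, h03 := h.h03, h09 := h.h09, n13 := h.n13, n19 := h.n19, n39 := h.n39
      h14 := h.h14, h34 := h.h34, h3c := h.h3c, h9c := h.h9c, h9a := h.h9a, h1a := h.h1a
      h12 := h.h12, h23 := h.h23, h36 := h.h36, h69 := h.h69, h95 := h.h95, h51 := h.h51
      h2b := w1, hb1 := w2, nb5 := w3, h67 := v1, h73 := v2, n72 := v3
      h58 := u1, h89 := u2, n86 := u3 }⟩

theorem arc_four_seven (hR : IsThirteenDigraph R) (h : Labelling R g) : R (g 4) (g 7) := by
  have n07 : g 0 ≠ g 7 := fun e => hR.no_trans (e ▸ h.h67) h.h09 h.h69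
  have n02 : g 0 ≠ g 2 := fun e => hR.asymm h.h01 (e ▸ h.h12)
  obtain ⟨z, hz0, h4z, hz3⟩ := hR.exists_path h.h34 (g 0)
  rcases hR.inn h.h03 h.h23 h.h73 n02 n07 h.n72.symm hz3 with rfl | rfl | rfl
  · exact absurd rfl hz0
  · exact absurd h.h12 (hR.no_trans h.h14 h4z)
  · exact h4z

theorem arc_seven_ten (hR : IsThirteenDigraph R) (h : Labelling R g) : R (g 7) (g 10) := by
  have h47 := hR.arc_four_seven h
  have h45 := hR.arc_four_five h.toStart
  have ha6 : R (g 10) (g 6) := hR.arc_four_five h.toStart.rotate.rotate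
  have h56 : R (g 5) (g 6) := hR.arc_two_five h.toStart.rotate.rotate
  have ha0 : R (g 10) (g 0) := hR.arc_four_zero h.toStart.rotate.rotate
  have n3a : g 3 ≠ g 10 := fun e => hR.asymm ha0 (e ▸ h.h03)
  have n35 : g 3 ≠ g 5 := fun e => hR.no_trans h.h03 (e ▸ h.h51) h.h01
  have na5 : g 10 ≠ g 5 := fun e => hR.asymm h.h1a (e ▸ h.h51)
  obtain ⟨z, hz3, h7z, hz6⟩ := hR.exists_path h.h67 (g 3)
  rcases hR.inn h.h36 ha6 h56 n3a n35 na5 hz6 with rfl | rfl | rfl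
  · exact absurd rfl hz3
  · exact h7z
  · exact absurd h45 (hR.no_trans h47 h7z)

theorem arc_seven_eight (hR : IsThirteenDigraph R) (h : Labelling R g) : R (g 7) (g 8) := by
  have h47 := hR.arc_four_seven h
  have h7a := hR.arc_seven_ten h
  have h84 : R (g 8) (g 4) := hR.arc_seven_ten h.rotate
  have n81 : g 8 ≠ g 1 := fun e => hR.no_trans h.h01 (e ▸ h.h89) h.h09
  have n83 : g 8 ≠ g 3 := fun e => hR.no_trans h.h03 (e ▸ h.h89) h.h09
  obtain ⟨z, hz3, h7z, hz4⟩ := hR.exists_path h47 (g 3)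
  rcases hR.inn h.h14 h.h34 h84 h.n13 n81.symm n83.symm hz4 with rfl | rfl | rfl
  · exact absurd h7a (hR.no_trans h7z h.h1a)
  · exact absurd rfl hz3
  · exact h7z

theorem arc_add_one (hR : IsThirteenDigraph R) (h : Labelling R g) (u : ZMod 13) :
    R (g u) (g (u + 1)) := by
  have h56 : R (g 5) (g 6) := hR.arc_two_five h.toStart.rotate.rotate
  have hab : R (g 10) (g 11) := hR.arc_four_seven h.rotate.rotate
  have hbc : R (g 11) (g 12) := hR.arc_seven_ten h.rotate.rotate
  have hc0 : R (g 12) (g 0) := hR.arc_four_zero h.toStart.rotate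
  have h45 := hR.arc_four_five h.toStart
  have h78 := hR.arc_seven_eight h
  match u with
  | 0 => exact h.h01
  | 1 => exact h.h12
  | 2 => exact h.h23
  | 3 => exact h.h34
  | 4 => exact h45
  | 5 => exact h56
  | 6 => exact h.h67
  | 7 => exact h78
  | 8 => exact h.h89
  | 9 => exact h.h9a
  | 10 => exact hab
  | 11 => exact hbc
  | 12 => exact hc0

/-- The labelling is an embedding of the Cayley digraph. -/
theorem Labelling.arc (hR : IsThirteenDigraph R) (h : Labelling R g) (u : ZMod 13) :
    R (g u) (g (u + 1)) ∧ R (g u) (g (u + 3)) ∧ R (g u) (g (u + 9)) := by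
  have key : ∀ {g : ZMod 13 → X} (_ : Labelling R g) (u : ZMod 13), R (g u) (g (u + 3)) := by
    intro g h u
    have := hR.arc_add_one h.rotate (9 * u)
    simp only [mul_add, ← mul_assoc, mul_one] at this
    rwa [show (3 * 9 : ZMod 13) = 1 from rfl, one_mul] at this
  refine ⟨hR.arc_add_one h u, key h u, ?_⟩
  have := key h.rotate (9 * u)
  simp only [mul_add, ← mul_assoc] at this
  rwa [show (3 * 9 : ZMod 13) = 1 from rfl, show (3 * 3 : ZMod 13) = 9 from rfl, one_mul] at this

/-- Distinct points of `ZMod 13` are joined by an arc or by a path of length two, so that arcs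
without opposite arcs separate them. -/
theorem Labelling.injective (hR : IsThirteenDigraph R) (h : Labelling R g) :
    Function.Injective g := by
  have hirr : ∀ x, ¬ R x x := fun x hx => hR.asymm hx hx
  have harc := fun u => h.arc hR u
  have hpath : ∀ u v : ZMod 13, u ≠ v →
      (v - u = 1 ∨ v - u = 3 ∨ v - u = 9) ∨ (u - v = 1 ∨ u - v = 3 ∨ u - v = 9) ∨
      ((v - u = 1 + 1 ∨ v - u = 3 + 3 ∨ v - u = 9 + 9) ∨
        (u - v = 1 + 1 ∨ u - v = 3 + 3 ∨ u - v = 9 + 9)) := by decide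
  have hdir : ∀ u v : ZMod 13, v - u = 1 ∨ v - u = 3 ∨ v - u = 9 → g u ≠ g v := by
    intro u v huv e
    obtain ⟨h1, h2, h3⟩ := harc u
    rcases huv with h | h | h <;> rw [sub_eq_iff_eq_add'] at h <;> rw [h] at e
    · exact hirr _ (e ▸ h1)
    · exact hirr _ (e ▸ h2)
    · exact hirr _ (e ▸ h3)
  have hdir2 : ∀ u v : ZMod 13, v - u = 1 + 1 ∨ v - u = 3 + 3 ∨ v - u = 9 + 9 → g u ≠ g v := by
    intro u v huv e
    rcases huv with h | h | h <;> rw [sub_eq_iff_eq_add', ← add_assoc] at h <;> rw [h] at e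
    · exact hR.asymm (harc u).1 (by conv_rhs => rw [e]
                                    exact (harc (u + 1)).1)
    · exact hR.asymm (harc u).2.1 (by conv_rhs => rw [e]
                                      exact (harc (u + 3)).2.1)
    · exact hR.asymm (harc u).2.2 (by conv_rhs => rw [e]
                                      exact (harc (u + 9)).2.2)
  intro u v e
  by_contra hne
  rcases hpath u v hne with h | h | h | h
  · exact hdir u v h e
  · exact hdir v u h e.symm
  · exact hdir2 u v h e
  · exact hdir2 v u h e.symm

end IsThirteenDigraph

namespace AssociationScheme
variable {X : Type*} [Fintype X] {d : ℕ} {S : AssociationScheme X d}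

/-! ### Isomorphism with the cyclotomic scheme -/

theorem ncard_common_out {i l : Fin (d + 1)} {x y : X} (hl : S.rel l x y) :
    {z | S.rel i x z ∧ S.rel i y z}.ncard = S.p i (S.star i) l := by
  rw [S.p_eq_ncard hl]
  simp only [S.rel_star]

namespace SparseGenerator
variable {i j : Fin (d + 1)}

theorem p_sq_le (h : S.SparseGenerator i j) (hb : S.p i i (S.star i) = 2) (ha : S.p i i i = 0)
    (hc : S.p i i j = 1) (l : Fin (d + 1)) :
    S.p i i l ≤ 2 ∧ (l ≠ S.star i → S.p i i l ≤ 1) := by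
  by_cases h0 : S.p i i l = 0
  · omega
  · rcases h.sq l h0 with rfl | rfl | rfl
    · omega
    · exact ⟨hb.le, fun e => absurd rfl e⟩
    · omega

theorem isThirteenDigraph (h : S.SparseGenerator i j) (hF : S.core i j = Finset.univ)
    (hk : S.valency i = 3) (ha : S.p i i i = 0) (hb : S.p i i (S.star i) = 2)
    (hc : S.p i i j = 1) (hf : S.p i (S.star i) j = 1) : IsThirteenDigraph (S.rel i) := by
  have hmem : ∀ {s : Set X} {a b c : X}, s.ncard = 3 → a ∈ s → b ∈ s → c ∈ s → a ≠ b → a ≠ c →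
      b ≠ c → s = {a, b, c} := by
    intro s a b c hs h1 h2 h3 hab hac hbc
    refine (Set.eq_of_subset_of_ncard_le ?_ ?_ (Set.toFinite _)).symm
    · rintro z (rfl | rfl | rfl) <;> assumption
    · rw [hs, Set.ncard_eq_three.2 ⟨a, b, c, hab, hac, hbc, rfl⟩]
  have hpath := fun {x y : X} {l} (hl : S.rel l x y) => S.p_eq_ncard (i := i) (j := i) hl
  have hle := h.p_sq_le hb ha hc
  constructor
  · intro x y h1 h2
    exact h.star_ne (S.rel_unique ((S.rel_star i _ _).2 h2) h1)
  · intro x y z h1 h2 h3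
    exact S.p_ne_zero h3 h1 h2 ha
  · intro x a b c e h1 h2 h3 hab hac hbc he
    have hn : {z | S.rel i x z}.ncard = 3 := by rw [← S.valency_eq_ncard, hk]
    have : e ∈ {z | S.rel i x z} := he
    rwa [hmem hn h1 h2 h3 hab hac hbc] at this
  · intro x a b c e h1 h2 h3 hab hac hbc he
    have hn : {z | S.rel i z x}.ncard = 3 := by
      rw [← hk, ← h.valency_star_left, S.valency_eq_ncard _ x]
      simp only [S.rel_star]
    have : e ∈ {z | S.rel i z x} := he
    rwa [hmem hn h1 h2 h3 hab hac hbc] at this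
  · intro x y z w hxy h1 h2 h3 h4
    obtain ⟨l, hl⟩ := S.exists_rel x y
    have hcard : {z | S.rel i x z ∧ S.rel i y z}.ncard ≤ 1 := by
      rw [ncard_common_out hl]
      rcases mem_core.1 (hF ▸ Finset.mem_univ l) with rfl | rfl | rfl | rfl | rfl
      · exact absurd ((S.rel_zero _ _).1 hl) hxy
      · rw [S.p_mul_star_self]
        omega
      · rw [S.p_mul_star_star, S.p_mul_star_self]
        omega
      · omega
      · rw [S.p_mul_star_star]
        omega
    exact (Set.ncard_le_one (Set.toFinite _)).1 hcard z ⟨h1, h2⟩ w ⟨h3, h4⟩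
  · intro x y hxy h1 h2
    obtain ⟨l, hl⟩ := S.exists_rel x y
    have hne : S.p i (S.star i) l ≠ 0 := by
      rcases mem_core.1 (hF ▸ Finset.mem_univ l) with rfl | rfl | rfl | rfl | rfl
      · exact absurd ((S.rel_zero _ _).1 hl) hxy
      · exact absurd hl h1
      · exact absurd ((S.rel_star _ _ _).1 hl) h2
      · omega
      · rw [S.p_mul_star_star]
        omega
    obtain ⟨z, hz1, hz2⟩ := (S.p_ne_zero_iff hl).1 hne
    exact ⟨z, hz1, (S.rel_star _ _ _).1 hz2⟩
  · intro x y hyx u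
    have hcard := hpath ((S.rel_star i x y).2 hyx)
    rw [hb] at hcard
    obtain ⟨z, hz, hzu⟩ := Set.exists_ne_of_one_lt_ncard (by rw [← hcard]; norm_num) u
    exact ⟨z, hzu, hz⟩
  · intro x y z w hyx h1 h2 h3 h4
    obtain ⟨l, hl⟩ := S.exists_rel x y
    have hl' : l ≠ S.star i := by
      rintro rfl
      exact hyx ((S.rel_star _ _ _).1 hl)
    have hcard := (hle l).2 hl'
    rw [hpath hl] at hcard
    exact (Set.ncard_le_one (Set.toFinite _)).1 hcard z ⟨h1, h2⟩ w ⟨h3, h4⟩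
  · intro x y a b c h1 h2 h3 h4 h5 h6
    obtain ⟨l, hl⟩ := S.exists_rel x y
    have hcard := (hle l).1
    rw [hpath hl] at hcard
    by_contra! hne
    have hsub : ({a, b, c} : Set X) ⊆ {z | S.rel i x z ∧ S.rel i z y} := by
      rintro z (rfl | rfl | rfl)
      exacts [⟨h1, h2⟩, ⟨h3, h4⟩, ⟨h5, h6⟩]
    have := Set.ncard_le_ncard hsub (Set.toFinite _)
    rw [Set.ncard_eq_three.2 ⟨a, b, c, hne.1, hne.2.1, hne.2.2, rfl⟩] at this
    omega

/-- The out-neighbours of a point form a cycle for `R_j`, from which a partial embedding starts. -/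
theorem exists_start (h : S.SparseGenerator i j)
    (hR : IsThirteenDigraph (S.rel i)) (hc : S.p i i j = 1) (hf : S.p i (S.star i) j = 1) :
    ∃ g : ZMod 13 → X, IsThirteenDigraph.Start (S.rel i) g := by
  have hirr : ∀ x, ¬ S.rel i x x := fun x hx => hR.asymm hx hx
  have hasymm : ∀ {x y}, S.rel j x y → ¬ S.rel j y x := fun h1 h2 =>
    h.star_ne' (S.rel_unique ((S.rel_star j _ _).2 h2) h1)
  have hne : ∀ {x y}, S.rel j x y → x ≠ y := fun h1 e => hasymm h1 (e ▸ e ▸ h1)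
  have hnext : ∀ {x y}, S.rel i x y → ∃ z, S.rel i x z ∧ S.rel j y z := by
    intro x y hxy
    have : S.p i (S.star j) i ≠ 0 := by
      rw [h.p_mul_right_star]
      omega
    obtain ⟨z, h1, h2⟩ := (S.p_ne_zero_iff hxy).1 this
    exact ⟨z, h1, (S.rel_star _ _ _).1 h2⟩
  have hmid : ∀ {x y}, S.rel j x y → ∃ z, S.rel i x z ∧ S.rel i z y := fun hxy =>
    (S.p_ne_zero_iff hxy).1 (by omega)
  have hcommon : ∀ {x y}, S.rel j x y → ∃ z, S.rel i x z ∧ S.rel i y z := by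
    intro x y hxy
    obtain ⟨z, h1, h2⟩ := (S.p_ne_zero_iff hxy).1 (by omega : S.p i (S.star i) j ≠ 0)
    exact ⟨z, h1, (S.rel_star _ _ _).1 h2⟩
  obtain ⟨x, y1, h01⟩ := S.rel_nonempty i
  obtain ⟨y3, h03, q13⟩ := hnext h01
  obtain ⟨y9, h09, q39⟩ := hnext h03
  have n19 : y1 ≠ y9 := fun e => hasymm q13 (e ▸ q39)
  have q91 : S.rel j y9 y1 := by
    obtain ⟨z, h0z, hz⟩ := hnext h09
    rcases hR.out h01 h03 h09 (hne q13) n19 (hne q39) h0z with rfl | rfl | rfl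
    · exact hz
    · exact absurd hz (hasymm q39)
    · exact absurd hz (hasymm hz)
  obtain ⟨y2, h12, h23⟩ := hmid q13
  obtain ⟨y6, h36, h69⟩ := hmid q39
  obtain ⟨y5, h95, h51⟩ := hmid q91
  obtain ⟨y4, h14, h34⟩ := hcommon q13
  obtain ⟨yc, h3c, h9c⟩ := hcommon q39
  obtain ⟨ya, h9a, h1a⟩ := hcommon q91
  exact ⟨(![x, y1, y2, y3, y4, y5, y6, x, x, y9, ya, x, yc] : Fin 13 → X),
    { h01 := h01, h03 := h03, h09 := h09, n13 := hne q13, n19 := n19, n39 := hne q39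
      h14 := h14, h34 := h34, h3c := h3c, h9c := h9c, h9a := h9a, h1a := h1a
      h12 := h12, h23 := h23, h36 := h36, h69 := h69, h95 := h95, h51 := h51 }⟩

/-- The relations `R_i` and `R_j` are those of the Cayley digraphs of `{1, 3, 9}` and `{2, 5, 6}`
on `ZMod 13`. -/
theorem exists_equiv (h : S.SparseGenerator i j) (hk : S.valency i ≠ 1) (hps : S.IsPseudocyclic) :
    ∃ f : X ≃ ZMod 13, ∀ x y,
      (S.rel i x y → f y - f x = 1 ∨ f y - f x = 3 ∨ f y - f x = 9) ∧
      (S.rel j x y → f y - f x = 2 ∨ f y - f x = 6 ∨ f y - f x = 5) := by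
  obtain ⟨hF, hk3, ha, hb, hc, hf⟩ := h.intersection_numbers hk hps
  have hR := h.isThirteenDigraph hF hk3 ha hb hc hf
  obtain ⟨g₀, hg₀⟩ := h.exists_start hR hc hf
  obtain ⟨g, hg⟩ := hR.exists_labelling hg₀
  have hinj := hg.injective hR
  have hbij : Function.Bijective g := by
    refine (Fintype.bijective_iff_injective_and_card g).2 ⟨hinj, ?_⟩
    rw [h.card_eq hF, hk3, ZMod.card]
  have hrel : ∀ u v, S.rel i (g u) (g v) → v - u = 1 ∨ v - u = 3 ∨ v - u = 9 := by
    intro u v huv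
    obtain ⟨h1, h3, h9⟩ := hg.arc hR u
    have hne : ∀ {r s : ZMod 13}, r ≠ s → g (u + r) ≠ g (u + s) := fun hrs e =>
      hrs (add_left_cancel (hinj e))
    rcases hR.out h1 h3 h9 (hne (by decide)) (hne (by decide)) (hne (by decide)) huv
      with e | e | e <;> rw [hinj e, add_sub_cancel_left] <;> tauto
  have hrel' : ∀ u v, S.rel j (g u) (g v) → v - u = 2 ∨ v - u = 6 ∨ v - u = 5 := by
    intro u v huv
    obtain ⟨z, h1, h2⟩ := (S.p_ne_zero_iff huv).1 (by omega : S.p i i j ≠ 0)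
    obtain ⟨w, rfl⟩ := hbij.2 z
    have hnot : ∀ r : ZMod 13, r = 1 ∨ r = 3 ∨ r = 9 → u ≠ v + r := by
      rintro r hr rfl
      have hvr : S.rel i (g v) (g (v + r)) := by
        obtain ⟨h1, h3, h9⟩ := hg.arc hR v
        rcases hr with rfl | rfl | rfl <;> assumption
      exact h.ne_star (S.rel_unique huv ((S.rel_star i _ _).2 hvr))
    have hfin : ∀ s t : ZMod 13, (s = 1 ∨ s = 3 ∨ s = 9) → (t = 1 ∨ t = 3 ∨ t = 9) →
        (s + t = 2 ∨ s + t = 6 ∨ s + t = 5) ∨ (-(s + t) = 1 ∨ -(s + t) = 3 ∨ -(s + t) = 9) := by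
      decide
    have hst : v - u = (w - u) + (v - w) := by ring
    rcases hfin _ _ (hrel _ _ h1) (hrel _ _ h2) with e | e
    · rwa [hst]
    · exact absurd (by ring) (hnot _ e)
  let f := (Equiv.ofBijective g hbij).symm
  have hf : ∀ x, g (f x) = x := (Equiv.ofBijective g hbij).apply_symm_apply
  exact ⟨f, fun x y => ⟨fun hxy => hrel _ _ (by rwa [hf, hf]), fun hxy => hrel' _ _ (by
    rwa [hf, hf])⟩⟩

end SparseGenerator

theorem isomorphic_of_forall_rel {Y : Type*} [Fintype Y] {e : ℕ} {T : AssociationScheme Y e}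
    (hde : d = e) (f : X ≃ Y) (h : ∀ l, ∃ m, ∀ x y, S.rel l x y → T.rel m (f x) (f y)) :
    S.Isomorphic T := by
  subst hde
  choose σ hσ using h
  have hsurj : Function.Surjective σ := by
    intro m
    obtain ⟨u, v, huv⟩ := T.rel_nonempty m
    obtain ⟨l, hl⟩ := S.exists_rel (f.symm u) (f.symm v)
    have := hσ l _ _ hl
    rw [f.apply_symm_apply, f.apply_symm_apply] at this
    exact ⟨l, T.rel_unique this huv⟩
  have hbij : Function.Bijective σ := Finite.surjective_iff_bijective.1 hsurj
  refine ⟨f, Equiv.ofBijective σ hbij, fun l x y => ⟨hσ l x y, fun hT => ?_⟩⟩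
  obtain ⟨l', hl'⟩ := S.exists_rel x y
  have : σ l' = σ l := T.rel_unique (hσ l' x y hl') hT
  rwa [← hbij.1 this]

/-- A coset of the group of cubic roots of unity of `ZMod 13` lies in one class of
`Cyc(13, 4)`. -/
theorem exists_cyclotomic_rel (α : (ZMod 13)ˣ) (hα : ∀ x : (ZMod 13)ˣ, x ∈ Subgroup.zpowers α)
    (w : ZMod 13) : ∃ m : Fin (4 + 1), ∀ u v : ZMod 13,
      v - u = w ∨ v - u = 3 * w ∨ v - u = 9 * w → Cyclotomic.Rel α 4 m v u := by
  have hd : 4 ∣ Fintype.card (ZMod 13) - 1 := by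
    rw [ZMod.card]
    norm_num
  obtain ⟨m, hm, -⟩ := Cyclotomic.partition α hα hd w 0
  have horder : orderOf α = 12 := by
    rw [orderOf_eq_card_of_forall_mem_zpowers hα, Nat.card_eq_fintype_card, ZMod.card_units]
  have hcube : ∀ c : (ZMod 13)ˣ, c ^ 3 = 1 → c ∈ Subgroup.zpowers (α ^ 4) := by
    intro c hc
    obtain ⟨k, rfl⟩ := Subgroup.mem_zpowers_iff.1 (hα c)
    rw [← zpow_natCast, ← zpow_mul, ← orderOf_dvd_iff_zpow_eq_one, horder] at hc
    obtain ⟨r, rfl⟩ : (4 : ℤ) ∣ k := by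
      push_cast at hc
      omega
    exact Subgroup.mem_zpowers_iff.2 ⟨r, by rw [zpow_mul]; norm_cast⟩
  have key : ∀ (c : ZMod 13) (u v : ZMod 13), c ^ 3 = 1 → v - u = c * w →
      Cyclotomic.Rel α 4 m v u := by
    intro c u v hc huv
    have hu : IsUnit c := IsUnit.of_pow_eq_one hc (by norm_num)
    obtain ⟨c, rfl⟩ := hu
    have := Cyclotomic.rel_affine α (hcube c (Units.ext (by simpa using hc))) u m hm
    rwa [← huv, mul_zero, zero_add, sub_add_cancel] at this
  refine ⟨m, fun u v huv => ?_⟩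
  rcases huv with e | e | e
  · exact key 1 u v (one_pow 3) (by rw [e, one_mul])
  · exact key 3 u v (by decide) e
  · exact key 9 u v (by decide) e

theorem SparseGenerator.isomorphic {i j : Fin (d + 1)} (h : S.SparseGenerator i j)
    (hk : S.valency i ≠ 1) (hps : S.IsPseudocyclic) (α : (ZMod 13)ˣ)
    (hα : ∀ x : (ZMod 13)ˣ, x ∈ Subgroup.zpowers α) (hd : 4 ∣ Fintype.card (ZMod 13) - 1) :
    S.Isomorphic (cyclotomicScheme α hα 4 hd) := by
  obtain ⟨hF, -⟩ := h.core_eq_univ_and hk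
  obtain ⟨f, hf⟩ := h.exists_equiv hk hps
  obtain ⟨m₁, h₁⟩ := exists_cyclotomic_rel α hα 1
  obtain ⟨m₂, h₂⟩ := exists_cyclotomic_rel α hα 2
  set T := cyclotomicScheme α hα 4 hd with hT
  -- The cyclotomic relations are defined through `x - y`, so the points are negated.
  have hi : ∀ x y, S.rel i x y → T.rel m₁ (-f x) (-f y) := by
    intro x y hxy
    refine h₁ _ _ ?_
    rw [neg_sub_neg, mul_one, mul_one]
    exact (hf x y).1 hxy
  have hj : ∀ x y, S.rel j x y → T.rel m₂ (-f x) (-f y) := by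
    intro x y hxy
    refine h₂ _ _ ?_
    rw [neg_sub_neg]
    exact (hf x y).2 hxy
  refine isomorphic_of_forall_rel (h.d_eq_four_of_core_eq_univ hF) (f.trans (Equiv.neg _)) ?_
  intro l
  rcases mem_core.1 (hF ▸ Finset.mem_univ l) with rfl | rfl | rfl | rfl | rfl
  · exact ⟨0, fun x y hxy => (T.rel_zero _ _).2 (congrArg _ ((S.rel_zero _ _).1 hxy))⟩
  · exact ⟨m₁, hi⟩
  · exact ⟨T.star m₁, fun x y hxy => (T.rel_star _ _ _).2 (hi y x ((S.rel_star _ _ _).1 hxy))⟩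
  · exact ⟨m₂, hj⟩
  · exact ⟨T.star m₂, fun x y hxy => (T.rel_star _ _ _).2 (hj y x ((S.rel_star _ _ _).1 hxy))⟩

theorem sparseGenerator_one_two (hcomm : S.IsCommutative) (hgen : S.Generates 1)
    (hns : ¬ S.IsSymmetricRelation 1)
    (h11 : S.complexProduct {1} {1} ⊆ {1, S.star 1, 2})
    (h11' : S.complexProduct {1} {S.star 1} ⊆ {0, 1, S.star 1, 2, S.star 2})
    (h2 : (2 : Fin (d + 1)) ∉ ({S.star 1, S.star 2} : Finset (Fin (d + 1))))
    (hk : S.valency 1 = S.valency 2) : S.SparseGenerator 1 2 := by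
  simp only [Finset.mem_insert, Finset.mem_singleton, not_or] at h2
  -- In `Fin (d + 1)` with `d ≤ 1`, the index `2` is `0`, whose relation is symmetric.
  have hd : 2 ≤ d := by
    by_contra hlt
    interval_cases d
    · exact hns (Subsingleton.elim (α := Fin 1) _ _)
    · exact h2.2 (S.star_zero.symm)
  refine ⟨hcomm, hgen, fun e => hns e.symm, fun e => h2.2 e.symm, ?_, h2.1, ?_, ?_, hk.symm⟩
  · obtain ⟨n, rfl⟩ := Nat.exists_eq_add_of_le' hd
    intro e
    have := congrArg Fin.val e
    simp only [Fin.coe_ofNat_eq_mod] at this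
    rw [Nat.mod_eq_of_lt (by omega), Nat.mod_eq_of_lt (by omega)] at this
    omega
  · intro l hl
    simpa using h11 (S.mem_complexProduct_singleton.2 hl)
  · intro l hl
    simpa using h11' (S.mem_complexProduct_singleton.2 hl)

end AssociationScheme

theorem theorem1p1 {X : Type*} [Fintype X] {d : ℕ} (S : AssociationScheme X d)
    (hcomm : S.IsCommutative) (hgen : S.Generates 1) (hns : ¬ S.IsSymmetricRelation 1)
    (h11 : S.complexProduct {1} {1} ⊆ {1, S.star 1, 2})
    (h11' : S.complexProduct {1} {S.star 1} ⊆ {0, 1, S.star 1, 2, S.star 2})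
    (h2 : (2 : Fin (d + 1)) ∉ ({S.star 1, S.star 2} : Finset (Fin (d + 1))))
    (hk : S.valency 1 = S.valency 2) (hk1 : 1 < S.valency 2) :
    d = 4 ∧ (S.IsPseudocyclic →
      ∀ (α : (ZMod 13)ˣ) (hα : ∀ x : (ZMod 13)ˣ, x ∈ Subgroup.zpowers α),
        S.Isomorphic (cyclotomicScheme α hα 4 (by rw [ZMod.card]; norm_num))) := by
  have h := AssociationScheme.sparseGenerator_one_two hcomm hgen hns h11 h11' h2 hk
  have hk' : S.valency 1 ≠ 1 := by omega
  exact ⟨h.d_eq_four_of_core_eq_univ (h.core_eq_univ_and hk').1,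
    fun hps α hα => h.isomorphic hk' hps α hα _⟩
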